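/- For $n\ge 1$ let $h_n=\sum_{k=1}^n \frac{1}{2k-1}$, let $\zeta_h(s)=\sum_{n\ge1} h_n n^{-s}$ for $\Re s>1$, let $\zeta(s,x)$ $(0<x<1)$ be the Hurwitz zeta function, continued to $s\in\mathbb{C}\setminus\{1\}$, and let $\zeta'(s,x)=\partial_s\zeta(s,x)$. (a) For $\Re s>1$ the series $\zeta_h(s)$ converges absolutely, the function $x\mapsto\zeta(2-s,\tfrac{2x}{\pi})\log\tan x$ is integrable on $(0,\pi/2)$, and if moreover $s$ is not an odd integer, then $$\zeta_h(s)=\frac{(2\pi)^{s-1}}{2\Gamma(s-1)\cos(\pi s/2)}\int_0^{\pi/2}\zeta\Big(2-s,\frac{2x}{\pi}\Big)\log(\tan x)\,dx .$$ (b) For every integer $n\ge1$ the function $x\mapsto\zeta'(1-2n,\tfrac{2x}{\pi})\log\tan x$ is integrable on $(0,\pi/2)$ and $$\zeta_h(2n+1)=\frac{(-1)^n2^{2n}\pi^{2n-1}}{(2n-1)!}\int_0^{\pi/2}\zeta'\Big(1-2n,\frac{2x}{\pi}\Big)\log(\tan x)\,dx .$$ (c) For $\Re z<1$ the integral $G(z)=\int_0^{\pi/2}\zeta(z,\tfrac{2x}{\pi})\log(\tan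 x)\,dx$ converges absolutely, and $G$ extends to a meromorphic function on $\mathbb{C}$ which is analytic outside the odd positive integers $1,3,5,\dots$ and has a pole at each of them. For $\Re z\ge1$, $z\ne1,3,5,\dots$, the extension is given by $$G(z)=-\frac{\pi}{2}\frac{1}{(1-z)^2}+\frac{\pi}{2}\frac{\log(\pi/2)}{1-z}+\frac{\pi}{2}\sum_{k=1}^\infty\Big(1-\frac1{2^{2k-1}}\Big)\frac{\zeta(2k)}{k(2k+1-z)}-\frac{1}{\pi\,\Gamma(z)}\int_0^\infty w(y)e^{-y}y^{z-1}\,dy,$$ where $w(y)=\sum_{n\ge1}\frac{h_n}{n^2+(y/2\pi)^2}$; the series over $k$ and the integral over $y$ converge absolutely there, and the series $w(y)$ converges for all $y>0$. With this $G$, the function that equals $\zeta_h(s)$ for $\Re s>1$ and $-2^{s-1}\pi^{s-2}\sin(\pi s/2)\Gamma(2-s)G(2-s)$ for $\Re s\le1$ is analytic on $\mathbb{C}\setminus\{1-2n: n=0,1,2,\dots\}$. -/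

import Mathlib

noncomputable section

/-- The odd harmonic numbers `h_n = ∑_{k=1}^n 1/(2k-1)`. -/
def oddHarmonic (n : ℕ) : ℝ := ∑ k ∈ Finset.Icc 1 n, 1 / (2 * (k : ℝ) - 1)

/-- The Dirichlet series `ζ_h(s) = ∑_{n ≥ 1} h_n / n ^ s` (used where it converges, `Re s > 1`). -/
def zetaH (s : ℂ) : ℂ := LSeries (fun n => (oddHarmonic n : ℂ)) s

/-- The integrand `ζ(z, 2x/π) log tan x`. On `0 < x < π/2` the parameter `2x/π` lies in `(0, 1)`,
where Mathlib's `hurwitzZeta` is the usual Hurwitz zeta function. -/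
def logTanHurwitz (z : ℂ) (x : ℝ) : ℂ :=
  HurwitzZeta.hurwitzZeta ((2 * x / Real.pi : ℝ) : UnitAddCircle) z
    * (Real.log (Real.tan x) : ℂ)

/-- The integrand `ζ'(z, 2x/π) log tan x`, the derivative being taken in the variable `z`. -/
def logTanHurwitzDeriv (z : ℂ) (x : ℝ) : ℂ :=
  deriv (HurwitzZeta.hurwitzZeta ((2 * x / Real.pi : ℝ) : UnitAddCircle)) z
    * (Real.log (Real.tan x) : ℂ)

/-- The terms `(1 - 1/2^(2k-1)) ζ(2k) / (k (2k + 1 - z))`, for `k ≥ 1`. -/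
def contTerm (z : ℂ) (k : ℕ) : ℂ :=
  (1 - 1 / 2 ^ (2 * k - 1)) * (riemannZeta (2 * k) / (k * (2 * k + 1 - z)))

/-- The terms `h_n / (n^2 + (y/2π)^2)`, for `n ≥ 1`. -/
def weightTerm (y : ℝ) (n : ℕ) : ℝ := oddHarmonic n / ((n : ℝ) ^ 2 + (y / (2 * Real.pi)) ^ 2)

/-- `w(y) = ∑_{n ≥ 1} h_n / (n^2 + (y/2π)^2)`. -/
def weightW (y : ℝ) : ℝ := ∑' n : ℕ, weightTerm y (n + 1)

/-- The integrand `w(y) e^{-y} y^{z-1}`. -/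
def weightIntegrand (z : ℂ) (y : ℝ) : ℂ :=
  (weightW y : ℂ) * (Real.exp (-y) : ℂ) * (y : ℂ) ^ (z - 1)

/-- The explicit formula for the continuation of the log-tangent integral to `Re z ≥ 1`. -/
def contFormula (z : ℂ) : ℂ :=
  -(Real.pi / 2) * (1 / (1 - z) ^ 2)
    + (Real.pi / 2) * ((Real.log (Real.pi / 2) : ℂ) / (1 - z))
    + (Real.pi / 2) * ∑' k : ℕ, contTerm z (k + 1)
    - 1 / Real.pi * (1 / Complex.Gamma z) * ∫ y in Set.Ioi (0 : ℝ), weightIntegrand z y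

end

section

open Real Set Filter Topology MeasureTheory

/-! With `u = 2x/π`, the function `log tan (π u / 2)` on `(0, 1)` is odd about `u = 1/2`, and its
sine coefficients are `-(2/π) h_n / n` (`integral_sin_mul_logTanUnit`). For `Re z < 0`, Hurwitz's
formula writes `ζ(z, u)` as a combination of the series `∑ e^{±2πinu} n^{z-1}`. Integrating these
term by term against `log tan` produces `∑ h_n n^{z-2} = ζ_h(2 - z)` times a Gamma factor and
`cos(πz/2)`. Both sides are analytic for `Re z < 1`, so the identity holds there
(`logTanMellin_eq`). Putting `z = 2 - s` and dividing by the cosine gives the formula for generic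
`s`. At `z = 1 - 2n` the cosine has a simple zero, and comparing derivatives gives the odd integers
instead.

For the continuation, work in `0 < Re z < 1` and split off `u^{-z}` from `ζ(z, u)`. The integral of
`u^{-z} log tan` follows from the power series of `log (tan x / x)`, whose coefficients come from
Euler's sine product; it yields all the polar terms. The rest is formally `∑_{n ≥ 0} (n + 1 +
u)^{-z}`. Writing each power as a Gamma integral reduces it to the Laplace transform of `log tan`,
which Fourier expansion identifies with `-(2/π²)(1 - e^{-y}) w(y)`, and the factor `1 - e^{-y}`
collapses the sum over `n`. The resulting formula (`contFormula_eq_logTanMellin`) makes sense for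
all `Re z > 0` and displays the poles. Combined with the reflection formula for Gamma, it also
continues `ζ_h`. -/

/-! ### Size, symmetry and integrability of `log tan (π u / 2)`. -/

/-- The function `log tan (π u / 2)` on the unit interval. -/
noncomputable def logTanUnit (u : ℝ) : ℝ := Real.log (Real.tan (π * u / 2))

lemma log_le_logTanUnit {u : ℝ} (hu : u ∈ Ioo (0 : ℝ) 1) : Real.log u ≤ logTanUnit u := by
  have h0 := hu.1
  have h1 := hu.2
  have hp := Real.pi_gt_three
  have : π * u / 2 < Real.tan (π * u / 2) :=
    Real.lt_tan (by positivity) (by nlinarith)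
  exact Real.log_le_log h0 (by nlinarith)

lemma logTanUnit_one_sub (u : ℝ) : logTanUnit (1 - u) = -logTanUnit u := by
  rw [logTanUnit, show π * (1 - u) / 2 = π / 2 - π * u / 2 by ring, Real.tan_pi_div_two_sub,
    Real.log_inv, logTanUnit]

lemma one_sub_mem_unit {u : ℝ} (hu : u ∈ Ioo (0 : ℝ) 1) : 1 - u ∈ Ioo (0 : ℝ) 1 :=
  ⟨by linarith [hu.2], by linarith [hu.1]⟩

/-- The inequality `x < tan x` gives the lower bound, and oddness about `1/2` turns it into the
upper one. -/
lemma abs_logTanUnit_le_log {u : ℝ} (hu : u ∈ Ioo (0 : ℝ) 1) :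
    |logTanUnit u| ≤ -Real.log u - Real.log (1 - u) := by
  have h1 := log_le_logTanUnit hu
  have h2 := log_le_logTanUnit (one_sub_mem_unit hu)
  rw [logTanUnit_one_sub] at h2
  have h3 : Real.log u ≤ 0 := Real.log_nonpos hu.1.le hu.2.le
  have h4 : Real.log (1 - u) ≤ 0 :=
    Real.log_nonpos (one_sub_mem_unit hu).1.le (one_sub_mem_unit hu).2.le
  rw [abs_le]
  constructor <;> linarith

lemma neg_log_le_rpow {u δ : ℝ} (hu : 0 < u) (hδ : 0 < δ) : -Real.log u ≤ u ^ (-δ) / δ := by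
  have := Real.log_le_rpow_div (inv_nonneg.2 hu.le) hδ
  rwa [Real.log_inv, Real.inv_rpow hu.le, ← Real.rpow_neg hu.le] at this

/-- The product form is chosen so that a Beta integrand dominates. -/
lemma abs_logTanUnit_le {u δ : ℝ} (hu : u ∈ Ioo (0 : ℝ) 1) (hδ : 0 < δ) :
    |logTanUnit u| ≤ 2 / δ * (u ^ (-δ) * (1 - u) ^ (-δ)) := by
  have hv := one_sub_mem_unit hu
  have h1 := neg_log_le_rpow hu.1 hδ
  have h2 := neg_log_le_rpow hv.1 hδ
  have h3 := Real.one_le_rpow_of_pos_of_le_one_of_nonpos hu.1 hu.2.le (neg_nonpos.2 hδ.le)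
  have h4 := Real.one_le_rpow_of_pos_of_le_one_of_nonpos hv.1 hv.2.le (neg_nonpos.2 hδ.le)
  have h5 := abs_logTanUnit_le_log hu
  have h6 : u ^ (-δ) + (1 - u) ^ (-δ) ≤ 2 * (u ^ (-δ) * (1 - u) ^ (-δ)) := by nlinarith
  calc |logTanUnit u| ≤ (u ^ (-δ) + (1 - u) ^ (-δ)) / δ := by rw [add_div]; linarith
    _ ≤ (2 * (u ^ (-δ) * (1 - u) ^ (-δ))) / δ := by gcongr
    _ = _ := by ring

@[fun_prop]
lemma measurable_logTanUnit : Measurable logTanUnit := by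
  have : logTanUnit = fun u : ℝ => Real.log (Real.sin (π * u / 2) / Real.cos (π * u / 2)) := by
    funext u; rw [logTanUnit, Real.tan_eq_sin_div_cos]
  rw [this]
  fun_prop

lemma integrableOn_rpow_mul_one_sub_rpow {a b : ℝ} (ha : a < 1) (hb : b < 1) :
    IntegrableOn (fun u : ℝ => u ^ (-a) * (1 - u) ^ (-b)) (Ioo 0 1) := by
  have h := Complex.betaIntegral_convergent (u := ((1 - a : ℝ) : ℂ)) (v := ((1 - b : ℝ) : ℂ))
    (by simpa using ha) (by simpa using hb)
  rw [intervalIntegrable_iff_integrableOn_Ioo_of_le zero_le_one] at h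
  refine IntegrableOn.congr_fun (Integrable.norm h) (fun u hu => ?_) measurableSet_Ioo
  have hv := one_sub_mem_unit hu
  have e : (1 : ℂ) - u = ((1 - u : ℝ) : ℂ) := by push_cast; ring
  simp only [norm_mul]
  rw [e, Complex.norm_cpow_eq_rpow_re_of_pos hu.1, Complex.norm_cpow_eq_rpow_re_of_pos hv.1]
  simp

lemma integrableOn_rpow_mul_logTanUnit {σ : ℝ} (hσ : σ < 1) :
    IntegrableOn (fun u : ℝ => u ^ (-σ) * |logTanUnit u|) (Ioo 0 1) := by
  -- Truncating `σ` at `0` ensures both `σ + δ < 1` and `δ < 1`, as the Beta integral requires, even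
  -- for very negative `σ`.
  set δ := (1 - max σ 0) / 2 with hδ
  have hm : max σ 0 < 1 := max_lt hσ one_pos
  have hm0 : 0 ≤ max σ 0 := le_max_right _ _
  have hδ0 : 0 < δ := by linarith
  have h := (integrableOn_rpow_mul_one_sub_rpow (a := σ + δ) (b := δ)
    (by linarith [le_max_left σ 0]) (by linarith)).const_mul (2 / δ)
  refine h.mono' ?_ ?_
  · exact (Measurable.mul (by fun_prop) (by fun_prop)).aestronglyMeasurable
  · filter_upwards [ae_restrict_mem measurableSet_Ioo] with u hu
    have hup := Real.rpow_pos_of_pos hu.1 (-σ)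
    rw [norm_mul, Real.norm_of_nonneg hup.le, Real.norm_of_nonneg (abs_nonneg _)]
    calc _ ≤ u ^ (-σ) * (2 / δ * (u ^ (-δ) * (1 - u) ^ (-δ))) := by
          gcongr; exact abs_logTanUnit_le hu hδ0
      _ = _ := by rw [neg_add, Real.rpow_add hu.1]; ring

lemma integrableOn_logTanUnit : IntegrableOn logTanUnit (Ioo 0 1) := by
  have h := integrableOn_rpow_mul_logTanUnit (σ := 0) one_pos
  simp only [neg_zero, Real.rpow_zero, one_mul] at h
  exact (integrable_norm_iff measurable_logTanUnit.aestronglyMeasurable).1 h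

lemma integrableOn_mul_logTanUnit {f : ℝ → ℂ} {C : ℝ}
    (hf : AEStronglyMeasurable f (volume.restrict (Ioo 0 1)))
    (hC : ∀ u ∈ Ioo (0 : ℝ) 1, ‖f u‖ ≤ C) :
    IntegrableOn (fun u : ℝ => f u * (logTanUnit u : ℂ)) (Ioo 0 1) := by
  refine (integrableOn_logTanUnit.ofReal (𝕜 := ℂ)).bdd_mul hf (c := C) ?_
  filter_upwards [ae_restrict_mem measurableSet_Ioo] with u hu using hC u hu

lemma integrableOn_self_mul_logTanUnit :
    IntegrableOn (fun u : ℝ => (u : ℂ) * (logTanUnit u : ℂ)) (Ioo 0 1) :=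
  integrableOn_mul_logTanUnit (C := 1) (Continuous.aestronglyMeasurable (by fun_prop))
    fun u hu => by
      rw [Complex.norm_real, Real.norm_of_nonneg hu.1.le]; exact hu.2.le

lemma integral_comp_one_sub_unit (f : ℝ → ℂ) :
    ∫ u in Ioo (0 : ℝ) 1, f (1 - u) = ∫ u in Ioo (0 : ℝ) 1, f u := by
  have := intervalIntegral.integral_comp_sub_left (a := 0) (b := 1) f 1
  simpa [intervalIntegral.integral_of_le, integral_Ioc_eq_integral_Ioo] using this

/-- `log tan (π u / 2)` is odd about `u = 1/2`. -/
lemma integral_mul_logTanUnit_of_symm {f : ℝ → ℂ} (hf : ∀ u ∈ Ioo (0 : ℝ) 1, f (1 - u) = f u) :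
    ∫ u in Ioo (0 : ℝ) 1, f u * (logTanUnit u : ℂ) = 0 := by
  have h := integral_comp_one_sub_unit (fun u => f u * (logTanUnit u : ℂ))
  have h2 : ∫ u in Ioo (0 : ℝ) 1, f (1 - u) * (logTanUnit (1 - u) : ℂ)
      = -∫ u in Ioo (0 : ℝ) 1, f u * (logTanUnit u : ℂ) := by
    rw [← integral_neg]
    refine setIntegral_congr_fun measurableSet_Ioo fun u hu => ?_
    simp only [hf u hu, logTanUnit_one_sub]
    push_cast; ring
  rw [h2] at h
  exact self_eq_neg.1 h.symm

lemma integral_logTanUnit : ∫ u in Ioo (0 : ℝ) 1, (logTanUnit u : ℂ) = 0 := by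
  simpa using integral_mul_logTanUnit_of_symm (f := fun _ => 1) (fun _ _ => rfl)

/-- The change of variables `u = 2x/π`. -/
lemma intervalIntegrable_comp_two_mul_div_pi_iff (f : ℝ → ℂ) :
    IntervalIntegrable (fun x => f (2 * x / π) * (Real.log (Real.tan x) : ℂ)) volume 0 (π / 2) ↔
      IntegrableOn (fun u => f u * (logTanUnit u : ℂ)) (Ioo 0 1) := by
  have hp := Real.pi_pos
  have h := IntervalIntegrable.comp_mul_left_iff (a := 0) (b := 1)
    (f := fun u => f u * (logTanUnit u : ℂ)) (c := 2 / π) (by positivity)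
  rw [← intervalIntegrable_iff_integrableOn_Ioo_of_le zero_le_one, ← h]
  have e : (fun x => f (2 / π * x) * (logTanUnit (2 / π * x) : ℂ)) =
      fun x => f (2 * x / π) * (Real.log (Real.tan x) : ℂ) := by
    funext x
    rw [logTanUnit, show π * (2 / π * x) / 2 = x by field_simp, div_mul_eq_mul_div]
  rw [e, zero_div, one_div_div]

lemma integral_comp_two_mul_div_pi (f : ℝ → ℂ) :
    ∫ x in (0 : ℝ)..(π / 2), f (2 * x / π) * (Real.log (Real.tan x) : ℂ) =
      π / 2 * ∫ u in Ioo (0 : ℝ) 1, f u * (logTanUnit u : ℂ) := by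
  have hp := Real.pi_pos
  have h := intervalIntegral.integral_comp_mul_left (a := 0) (b := π / 2)
    (fun u => f u * (logTanUnit u : ℂ)) (c := 2 / π) (by positivity)
  have e : (2 / π * (π / 2)) = 1 := by field_simp
  rw [mul_zero, e, intervalIntegral.integral_of_le zero_le_one,
    integral_Ioc_eq_integral_Ioo] at h
  convert h using 1
  · refine intervalIntegral.integral_congr fun x _ => ?_
    congr 1
    · congr 1; ring
    · rw [logTanUnit]; congr 3; field_simp
  · rw [inv_div, Complex.real_smul]; push_cast; rfl

/-! ### Odd harmonic numbers and their Dirichlet series. -/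

lemma oddHarmonic_nonneg (n : ℕ) : 0 ≤ oddHarmonic n := by
  refine Finset.sum_nonneg fun k hk => ?_
  have : (1 : ℝ) ≤ k := by exact_mod_cast (Finset.mem_Icc.1 hk).1
  exact div_nonneg zero_le_one (by linarith)

lemma oddHarmonic_zero : oddHarmonic 0 = 0 := by simp [oddHarmonic]

lemma oddHarmonic_succ (n : ℕ) : oddHarmonic (n + 1) = oddHarmonic n + 1 / (2 * n + 1) := by
  rw [oddHarmonic, Finset.sum_Icc_succ_top (by omega), ← oddHarmonic]
  push_cast; ring_nf

lemma oddHarmonic_le (n : ℕ) : oddHarmonic n ≤ 1 + Real.log n := by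
  refine le_trans ?_ (harmonic_le_one_add_log n)
  simp_rw [harmonic_eq_sum_Icc, Rat.cast_sum, Rat.cast_inv, Rat.cast_natCast]
  refine Finset.sum_le_sum fun k hk => ?_
  have : (1 : ℝ) ≤ k := by exact_mod_cast (Finset.mem_Icc.1 hk).1
  rw [← one_div]
  gcongr
  linarith

lemma norm_oddHarmonic_le {δ : ℝ} (hδ : 0 < δ) {n : ℕ} (hn : n ≠ 0) :
    ‖(oddHarmonic n : ℂ)‖ ≤ (1 + 1 / δ) * (n : ℝ) ^ δ := by
  rw [Complex.norm_of_nonneg (oddHarmonic_nonneg n)]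
  have h1 : (1 : ℝ) ≤ (n : ℝ) ^ δ :=
    Real.one_le_rpow (by exact_mod_cast Nat.one_le_iff_ne_zero.2 hn) hδ.le
  have h2 := Real.log_natCast_le_rpow_div n hδ
  calc _ ≤ 1 + Real.log n := oddHarmonic_le n
    _ ≤ (n : ℝ) ^ δ + (n : ℝ) ^ δ / δ := add_le_add h1 h2
    _ = _ := by ring

lemma lseriesSummable_oddHarmonic {s : ℂ} (hs : 1 < s.re) :
    LSeriesSummable (fun n => (oddHarmonic n : ℂ)) s := by
  have hδ : 0 < (s.re - 1) / 2 := by linarith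
  refine LSeriesSummable_of_le_const_mul_rpow (x := 1 + (s.re - 1) / 2) (by linarith)
    ⟨1 + 1 / ((s.re - 1) / 2), fun n hn => ?_⟩
  rw [add_sub_cancel_left]
  exact norm_oddHarmonic_le hδ hn

lemma abscissaOfAbsConv_oddHarmonic_le :
    LSeries.abscissaOfAbsConv (fun n => (oddHarmonic n : ℂ)) ≤ 1 := by
  have := LSeries.abscissaOfAbsConv_le_of_forall_lt_LSeriesSummable (x := 1)
    (f := fun n => (oddHarmonic n : ℂ)) fun y hy => lseriesSummable_oddHarmonic (by simpa using hy)
  simpa using this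

lemma analyticOnNhd_zetaH : AnalyticOnNhd ℂ zetaH {s | 1 < s.re} := fun s hs =>
  LSeries_analyticOnNhd _ s (lt_of_le_of_lt abscissaOfAbsConv_oddHarmonic_le (by
    have : ((1 : ℝ) : EReal) < (s.re : EReal) := EReal.coe_lt_coe_iff.2 hs
    simpa using this))

lemma hasSum_zetaH {s : ℂ} (hs : 1 < s.re) :
    HasSum (fun n : ℕ => (oddHarmonic n : ℂ) / (n : ℂ) ^ s) (zetaH s) := by
  have h := (lseriesSummable_oddHarmonic hs).hasSum
  refine h.congr_fun fun n => ?_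
  rcases eq_or_ne n 0 with rfl | hn
  · simp [oddHarmonic_zero]
  · rw [LSeries.term_of_ne_zero hn]

lemma summable_oddHarmonic_div_sq : Summable fun n : ℕ => oddHarmonic n / (n : ℝ) ^ 2 := by
  have h := (hasSum_zetaH (s := 2) (by norm_num)).summable
  rw [← Complex.summable_ofReal]
  simpa using h

lemma hasSum_oddHarmonic_div_sq :
    HasSum (fun n : ℕ => (oddHarmonic n : ℂ) / (n : ℂ) ^ 2) (zetaH 2) := by
  simpa using hasSum_zetaH (s := 2) (by norm_num)

/-! ### Fourier coefficients of `log tan (π u / 2)`. -/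

lemma two_mul_sin_mul_sum_sin (θ : ℝ) (n : ℕ) :
    2 * Real.sin θ * ∑ k ∈ Finset.range n, Real.sin ((2 * k + 1) * θ) =
      1 - Real.cos (2 * n * θ) := by
  induction n with
  | zero => simp
  | succ n ih =>
    rw [Finset.sum_range_succ, mul_add, ih, mul_comm (2 : ℝ) (Real.sin θ)]
    have h1 : Real.cos (2 * n * θ) = Real.cos ((2 * n + 1) * θ - θ) := by ring_nf
    have h2 : Real.cos (2 * (n + 1 : ℕ) * θ) = Real.cos ((2 * n + 1) * θ + θ) := by
      push_cast; ring_nf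
    rw [h1, h2, Real.cos_sub, Real.cos_add]
    ring

lemma oddHarmonic_eq_sum_range (n : ℕ) :
    oddHarmonic n = ∑ k ∈ Finset.range n, 1 / (2 * (k : ℝ) + 1) := by
  induction n with
  | zero => simp [oddHarmonic]
  | succ n ih => rw [Finset.sum_range_succ, oddHarmonic_succ, ih]

lemma hasDerivAt_logTanUnit {u : ℝ} (hu : u ∈ Ioo (0 : ℝ) 1) :
    HasDerivAt logTanUnit (π / Real.sin (π * u)) u := by
  have hp := Real.pi_pos
  have h1 : 0 < Real.cos (π * u / 2) :=
    Real.cos_pos_of_mem_Ioo ⟨by nlinarith [hu.1], by nlinarith [hu.2]⟩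
  have h2 : 0 < Real.sin (π * u / 2) :=
    Real.sin_pos_of_pos_of_lt_pi (by nlinarith [hu.1]) (by nlinarith [hu.2])
  have h3 : HasDerivAt (fun u : ℝ => π * u / 2) (π / 2) u := by
    simpa using ((hasDerivAt_id u).const_mul π).div_const 2
  have h4 := ((Real.hasDerivAt_tan h1.ne').comp u h3).log
    (by simp only [Function.comp]; rw [Real.tan_eq_sin_div_cos]; positivity)
  have e : Real.sin (π * u) = 2 * Real.sin (π * u / 2) * Real.cos (π * u / 2) := by
    rw [← Real.sin_two_mul]; ring_nf
  refine h4.congr_deriv ?_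
  simp only [Function.comp]
  rw [e, Real.tan_eq_sin_div_cos]
  field_simp

lemma one_sub_cos_le_mul (n : ℕ) (u : ℝ) :
    |1 - Real.cos (2 * π * n * u)| ≤ 2 * π ^ 2 * n ^ 2 * u ^ 2 := by
  rw [abs_of_nonneg (by linarith [Real.cos_le_one (2 * π * n * u)])]
  have := Real.one_sub_sq_div_two_le_cos (x := 2 * π * n * u)
  nlinarith

lemma tendsto_one_sub_cos_mul_logTanUnit (n : ℕ) :
    Tendsto (fun u => (1 - Real.cos (2 * π * n * u)) * logTanUnit u) (𝓝[>] 0) (𝓝 0) := by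
  have h : Tendsto (fun u : ℝ => 2 * π ^ 2 * n ^ 2 * u * (2 * (1 - u) ^ (-1 : ℝ))) (𝓝[>] 0)
      (𝓝 (2 * π ^ 2 * n ^ 2 * 0 * (2 * (1 - 0) ^ (-1 : ℝ)))) := by
    apply Tendsto.mono_left _ nhdsWithin_le_nhds
    apply ContinuousAt.tendsto (f := fun u : ℝ => 2 * π ^ 2 * n ^ 2 * u * (2 * (1 - u) ^ (-1 : ℝ)))
    refine ContinuousAt.mul (by fun_prop) (continuousAt_const.mul ?_)
    exact ContinuousAt.rpow_const (by fun_prop) (Or.inl (by norm_num))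
  rw [mul_zero, zero_mul] at h
  refine squeeze_zero_norm' ?_ h
  filter_upwards [Ioo_mem_nhdsGT (zero_lt_one (α := ℝ))] with u hu
  have h1 := abs_logTanUnit_le hu one_pos
  have hu0 := hu.1
  have h2 : u ^ 2 * u ^ (-1 : ℝ) = u := by
    rw [Real.rpow_neg_one]; field_simp
  rw [norm_mul, Real.norm_eq_abs, Real.norm_eq_abs]
  calc _ ≤ (2 * π ^ 2 * n ^ 2 * u ^ 2) * (2 / 1 * (u ^ (-1 : ℝ) * (1 - u) ^ (-1 : ℝ))) := by
        gcongr
        exact one_sub_cos_le_mul n u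
    _ = 2 * π ^ 2 * n ^ 2 * (u ^ 2 * u ^ (-1 : ℝ)) * (2 * (1 - u) ^ (-1 : ℝ)) := by ring
    _ = _ := by rw [h2]

lemma tendsto_one_sub_cos_mul_logTanUnit_one (n : ℕ) :
    Tendsto (fun u => (1 - Real.cos (2 * π * n * u)) * logTanUnit u) (𝓝[<] 1) (𝓝 0) := by
  have h : Tendsto (fun u : ℝ => 1 - u) (𝓝[<] 1) (𝓝[>] 0) := by
    refine tendsto_nhdsWithin_iff.2 ⟨?_, ?_⟩
    · have : Tendsto (fun u : ℝ => 1 - u) (𝓝 1) (𝓝 (1 - 1)) := Continuous.tendsto (by fun_prop) 1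
      rw [sub_self] at this
      exact this.mono_left nhdsWithin_le_nhds
    · filter_upwards [self_mem_nhdsWithin] with u hu
      simpa using hu
  have h2 := ((tendsto_one_sub_cos_mul_logTanUnit n).comp h).neg
  rw [neg_zero] at h2
  refine h2.congr fun u => ?_
  simp only [Function.comp]
  rw [logTanUnit_one_sub, show 2 * π * n * (1 - u) = n * (2 * π) - 2 * π * n * u by ring,
    Real.cos_nat_mul_two_pi_sub]
  ring

/-- Integration by parts. The antiderivative `1 - cos(2πnu)` of the sine (up to scale) vanishes to
second order at both endpoints, which kills the logarithmic singularities. Its quotient by `sin(πu)`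
is a sum of sines of odd multiples of `πu`, whose primitive has boundary values that are multiples
of `h_n`. -/
lemma integral_sin_mul_logTanUnit (n : ℕ) (hn : n ≠ 0) :
    ∫ u in Ioo (0 : ℝ) 1, Real.sin (2 * π * n * u) * logTanUnit u =
      -(2 / π) * (oddHarmonic n / n) := by
  have hp := Real.pi_pos
  have hn' : (0 : ℝ) < n := by positivity
  -- A primitive of `2πn sin(2πnu) log tan(πu/2)`, tending to `2 h_n` at `0` and to `-2 h_n` at `1`.
  set Φ : ℝ → ℝ := fun u => (1 - Real.cos (2 * π * n * u)) * logTanUnit u +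
    2 * ∑ k ∈ Finset.range n, Real.cos ((2 * k + 1) * (π * u)) / (2 * (k : ℝ) + 1) with hΦ
  have hcont : Continuous fun u : ℝ =>
      2 * ∑ k ∈ Finset.range n, Real.cos ((2 * k + 1) * (π * u)) / (2 * (k : ℝ) + 1) := by
    fun_prop
  have h0 : Tendsto Φ (𝓝[>] 0) (𝓝 (2 * oddHarmonic n)) := by
    have := (tendsto_one_sub_cos_mul_logTanUnit n).add
      ((hcont.tendsto 0).mono_left nhdsWithin_le_nhds)
    simpa [oddHarmonic_eq_sum_range] using this
  have h1 : Tendsto Φ (𝓝[<] 1) (𝓝 (-(2 * oddHarmonic n))) := by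
    have := (tendsto_one_sub_cos_mul_logTanUnit_one n).add
      ((hcont.tendsto 1).mono_left nhdsWithin_le_nhds)
    have e (k : ℕ) : Real.cos ((2 * k + 1) * (π * 1)) = -1 := by
      rw [show (2 * (k : ℝ) + 1) * (π * 1) = k * (2 * π) + π by ring, Real.cos_nat_mul_two_pi_add_pi]
    simp only [e, zero_add] at this
    convert this using 2
    rw [oddHarmonic_eq_sum_range, ← mul_neg, ← Finset.sum_neg_distrib]
    simp only [neg_div]
  have hd : ∀ u ∈ Ioo (0 : ℝ) 1,
      HasDerivAt Φ (2 * π * n * (Real.sin (2 * π * n * u) * logTanUnit u)) u := by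
    intro u hu
    have hs : 0 < Real.sin (π * u) :=
      Real.sin_pos_of_pos_of_lt_pi (by nlinarith [hu.1]) (by nlinarith [hu.2])
    have hc : HasDerivAt (fun u : ℝ => 1 - Real.cos (2 * π * n * u))
        (2 * π * n * Real.sin (2 * π * n * u)) u := by
      have := (((hasDerivAt_id u).const_mul (2 * π * n)).cos).const_sub 1
      convert! this using 1
      simp
      ring
    have hsum : HasDerivAt (fun u : ℝ => 2 * ∑ k ∈ Finset.range n,
        Real.cos ((2 * k + 1) * (π * u)) / (2 * (k : ℝ) + 1))
        (2 * ∑ k ∈ Finset.range n, -(π * Real.sin ((2 * k + 1) * (π * u)))) u := by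
      refine HasDerivAt.const_mul 2 (HasDerivAt.fun_sum fun k _ => ?_)
      have := ((((hasDerivAt_id u).const_mul π).const_mul (2 * (k : ℝ) + 1)).cos).div_const
        (2 * (k : ℝ) + 1)
      have hk : (2 * (k : ℝ) + 1) ≠ 0 := by positivity
      refine this.congr_deriv ?_
      simp only [id]
      field_simp
    refine ((hc.mul (hasDerivAt_logTanUnit hu)).add hsum).congr_deriv ?_
    have key := two_mul_sin_mul_sum_sin (π * u) n
    rw [show 2 * π * n * u = 2 * n * (π * u) by ring, ← key, Finset.sum_neg_distrib,
      ← Finset.mul_sum]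
    field_simp
    ring
  have hint : IntervalIntegrable (fun u => 2 * π * n * (Real.sin (2 * π * n * u) * logTanUnit u))
      volume 0 1 := by
    rw [intervalIntegrable_iff_integrableOn_Ioo_of_le zero_le_one]
    refine Integrable.const_mul ?_ _
    refine integrableOn_logTanUnit.bdd_mul (c := 1) (by fun_prop) ?_
    exact Eventually.of_forall fun u => Real.abs_sin_le_one _
  have := intervalIntegral.integral_eq_sub_of_hasDerivAt_of_tendsto zero_lt_one hd hint h0 h1
  rw [intervalIntegral.integral_of_le zero_le_one, integral_Ioc_eq_integral_Ioo,
    integral_const_mul] at this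
  have hne : 2 * π * n ≠ 0 := by positivity
  apply mul_left_cancel₀ hne
  rw [this]
  field_simp
  ring

/-- The Fourier coefficients of `log tan (π u / 2)`. -/
lemma integral_exp_mul_logTanUnit (n : ℕ) :
    ∫ u in Ioo (0 : ℝ) 1, Complex.exp (2 * π * Complex.I * u * n) * (logTanUnit u : ℂ) =
      -(2 * Complex.I / π) * (oddHarmonic n / n) := by
  -- At `n = 0` the right side is `0`, since `h_0 = 0`, in agreement with the vanishing mean of `log
  -- tan`.
  rcases eq_or_ne n 0 with rfl | hn
  · simpa using integral_logTanUnit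
  have e (u : ℝ) : Complex.exp (2 * π * Complex.I * u * n) * (logTanUnit u : ℂ) =
      (Real.cos (2 * π * n * u) : ℂ) * (logTanUnit u : ℂ) +
      Complex.I * ((Real.sin (2 * π * n * u) : ℂ) * (logTanUnit u : ℂ)) := by
    rw [show 2 * π * Complex.I * u * n = ((2 * π * n * u : ℝ) : ℂ) * Complex.I by push_cast; ring,
      Complex.exp_mul_I, ← Complex.ofReal_cos, ← Complex.ofReal_sin]
    ring
  simp only [e]
  have hc : IntegrableOn (fun u : ℝ => (Real.cos (2 * π * n * u) : ℂ) * (logTanUnit u : ℂ))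
      (Ioo 0 1) := integrableOn_mul_logTanUnit (C := 1)
        (Continuous.aestronglyMeasurable (by fun_prop)) fun u _ => by
      rw [Complex.norm_real]; exact Real.abs_cos_le_one _
  have hs : IntegrableOn (fun u : ℝ => (Real.sin (2 * π * n * u) : ℂ) * (logTanUnit u : ℂ))
      (Ioo 0 1) := integrableOn_mul_logTanUnit (C := 1)
        (Continuous.aestronglyMeasurable (by fun_prop)) fun u _ => by
      rw [Complex.norm_real]; exact Real.abs_sin_le_one _
  rw [integral_add hc (Integrable.const_mul hs _), integral_const_mul,
    integral_mul_logTanUnit_of_symm (f := fun u => (Real.cos (2 * π * n * u) : ℂ)), zero_add]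
  · simp only [← Complex.ofReal_mul]
    rw [integral_complex_ofReal, integral_sin_mul_logTanUnit n hn]
    push_cast; ring
  · intro u _
    rw [show 2 * π * n * (1 - u) = n * (2 * π) - 2 * π * n * u by ring,
      Real.cos_nat_mul_two_pi_sub]

lemma integral_exp_neg_mul_logTanUnit (n : ℕ) :
    ∫ u in Ioo (0 : ℝ) 1, Complex.exp (-(2 * π * Complex.I * u * n)) * (logTanUnit u : ℂ) =
      (2 * Complex.I / π) * (oddHarmonic n / n) := by
  rw [← neg_inj, ← neg_mul, ← integral_exp_mul_logTanUnit, ← integral_comp_one_sub_unit,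
    ← integral_neg]
  refine integral_congr_ae (Eventually.of_forall fun u => ?_)
  simp only [logTanUnit_one_sub]
  have : Complex.exp (-(2 * π * Complex.I * ((1 - u : ℝ) : ℂ) * n)) =
      Complex.exp (2 * π * Complex.I * u * n) := by
    rw [Complex.exp_eq_exp_iff_exists_int]
    exact ⟨-n, by push_cast; ring⟩
  rw [this]
  push_cast; ring

/-! ### Holomorphic dependence of integrals on a parameter. -/

/-- Differentiation under the integral sign for a locally dominated holomorphic family. -/
lemma hasDerivAt_integral_of_locally_dominated {α : Type*} [MeasurableSpace α] {μ : Measure α}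
    {U : Set ℂ} (hU : IsOpen U) {F : ℂ → α → ℂ}
    (hmeas : ∀ z ∈ U, AEStronglyMeasurable (F z) μ)
    (hdiff : ∀ᵐ u ∂μ, DifferentiableOn ℂ (fun z => F z u) U)
    (hbd : ∀ z₀ ∈ U, ∃ r > 0, ∃ g : α → ℝ, Integrable g μ ∧
      ∀ᵐ u ∂μ, ∀ z ∈ Metric.ball z₀ r, ‖F z u‖ ≤ g u)
    {z₀ : ℂ} (hz₀ : z₀ ∈ U) :
    Integrable (fun u => deriv (fun z => F z u) z₀) μ ∧
      HasDerivAt (fun z => ∫ u, F z u ∂μ) (∫ u, deriv (fun z => F z u) z₀ ∂μ) z₀ := by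
  obtain ⟨r, hr, g, hg, hFg⟩ := hbd z₀ hz₀
  obtain ⟨r', hr', hball⟩ := Metric.isOpen_iff.1 hU z₀ hz₀
  -- Closed balls of radius `R` about points of `ball z₀ R` stay inside both the domination ball and
  -- `U`, so Cauchy's estimate bounds the derivative by `g / R`.
  set R := min r r' / 3 with hR
  have hR0 : 0 < R := by positivity
  have hRr : 3 * R ≤ r := by rw [hR]; linarith [min_le_left r r']
  have hRr' : 3 * R ≤ r' := by rw [hR]; linarith [min_le_right r r']
  have hsub : ∀ z ∈ Metric.ball z₀ R, Metric.closedBall z R ⊆ Metric.ball z₀ r ∩ U := by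
    intro z hz w hw
    have h1 := Metric.mem_ball.1 hz
    have h2 := Metric.mem_closedBall.1 hw
    have h3 := dist_triangle w z z₀
    exact ⟨Metric.mem_ball.2 (by linarith), hball (Metric.mem_ball.2 (by linarith))⟩
  have hself (z : ℂ) : z ∈ Metric.closedBall z R := Metric.mem_closedBall_self hR0.le
  have hmem0 : z₀ ∈ Metric.ball z₀ R := Metric.mem_ball_self hR0
  have hderivmeas : AEStronglyMeasurable (fun u => deriv (fun z => F z u) z₀) μ := by
    -- The derivative is measurable as an almost everywhere limit of difference quotients along this
    -- null sequence; the shift `n + 2` keeps every step inside the ball of radius `R`.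
    set t : ℕ → ℂ := fun n => ((R / (n + 2) : ℝ) : ℂ) with ht
    have htpos (n : ℕ) : 0 < R / (n + 2) := by positivity
    have htne (n : ℕ) : t n ≠ 0 := Complex.ofReal_ne_zero.2 (htpos n).ne'
    have htlim : Tendsto t atTop (𝓝[≠] 0) := by
      refine tendsto_nhdsWithin_iff.2 ⟨?_, Eventually.of_forall htne⟩
      have h1 : Tendsto (fun n : ℕ => R / ((n : ℝ) + 2)) atTop (𝓝 0) :=
        tendsto_const_nhds.div_atTop
          (tendsto_atTop_add_const_right _ _ tendsto_natCast_atTop_atTop)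
      have h2 := (Complex.continuous_ofReal.tendsto 0).comp h1
      rwa [Complex.ofReal_zero] at h2
    refine aestronglyMeasurable_of_tendsto_ae atTop
      (f := fun n u => (t n)⁻¹ • (F (z₀ + t n) u - F z₀ u)) (fun n => ?_) ?_
    · have hmem : z₀ + t n ∈ U := by
        refine (hsub z₀ hmem0 ?_).2
        rw [Metric.mem_closedBall, dist_eq_norm, add_sub_cancel_left, ht, Complex.norm_real,
          Real.norm_of_nonneg (htpos n).le]
        exact div_le_self hR0.le (by linarith [(n.cast_nonneg : (0 : ℝ) ≤ n)])
      simp only [smul_eq_mul]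
      exact ((hmeas _ hmem).sub (hmeas _ hz₀)).const_mul _
    · filter_upwards [hdiff] with u hu
      have := (hu.differentiableAt (hU.mem_nhds hz₀)).hasDerivAt
      exact (hasDerivAt_iff_tendsto_slope_zero.1 this).comp htlim
  refine hasDerivAt_integral_of_dominated_loc_of_deriv_le (Metric.ball_mem_nhds z₀ hR0)
    (F' := fun z u => deriv (fun z => F z u) z)
    (bound := fun u => g u / R) ?_ ?_ hderivmeas ?_ (hg.div_const R) ?_
  · filter_upwards [hU.mem_nhds hz₀] with z hz using hmeas z hz
  · refine hg.mono' (hmeas _ hz₀) ?_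
    filter_upwards [hFg] with u hu using hu z₀ (Metric.mem_ball_self hr)
  · filter_upwards [hFg, hdiff] with u hu hd z hz
    refine Complex.norm_deriv_le_of_forall_mem_sphere_norm_le hR0 ?_ fun w hw => ?_
    · refine DifferentiableOn.diffContOnCl ?_
      rw [closure_ball _ hR0.ne']
      exact hd.mono fun w hw => (hsub z hz hw).2
    · exact hu w (hsub z hz (Metric.sphere_subset_closedBall hw)).1
  · filter_upwards [hdiff] with u hd z hz
    exact (hd.differentiableAt (hU.mem_nhds (hsub z hz (hself z)).2)).hasDerivAt

/-! ### Hurwitz's formula and the integral for `Re z < 0`. -/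

lemma norm_exp_div_natCast_cpow_le (a : ℝ) {s : ℂ} (n : ℕ) (hs : 1 < s.re) :
    ‖Complex.exp (2 * π * Complex.I * a * n) / (n : ℂ) ^ s‖ ≤ 1 / (n : ℝ) ^ s.re := by
  rw [norm_div, show 2 * π * Complex.I * a * n = ((2 * π * a * n : ℝ) : ℂ) * Complex.I by
    push_cast; ring, Complex.norm_exp_ofReal_mul_I, Complex.norm_natCast_cpow_of_re_ne_zero _
    (by linarith)]

lemma norm_expZeta_le (a : ℝ) {s : ℂ} {σ : ℝ} (hσ : 1 < σ) (hs : σ ≤ s.re) :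
    ‖HurwitzZeta.expZeta a s‖ ≤ ∑' n : ℕ, 1 / (n : ℝ) ^ σ := by
  have hs1 : 1 < s.re := by linarith
  rw [← (HurwitzZeta.hasSum_expZeta_of_one_lt_re a hs1).tsum_eq]
  refine tsum_of_norm_bounded (Real.summable_one_div_nat_rpow.2 hσ).hasSum fun n => ?_
  refine (norm_exp_div_natCast_cpow_le a n hs1).trans ?_
  rcases Nat.eq_zero_or_pos n with rfl | hn
  · rw [Nat.cast_zero, Real.zero_rpow (by linarith), Real.zero_rpow (by linarith)]
  · have : (1 : ℝ) ≤ n := by exact_mod_cast hn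
    have h0 : (0 : ℝ) < n := by linarith
    gcongr

lemma continuous_expZeta {s : ℂ} (hs : 1 < s.re) :
    Continuous fun a : ℝ => HurwitzZeta.expZeta a s := by
  simp_rw [← fun a : ℝ => (HurwitzZeta.hasSum_expZeta_of_one_lt_re a hs).tsum_eq]
  refine continuous_tsum (fun n => ?_) (Real.summable_one_div_nat_rpow.2 hs)
    fun n a => norm_exp_div_natCast_cpow_le a n hs
  fun_prop

/-- The values `ε = 1` and `ε = -1` are the two arguments in Hurwitz's formula. Termwise integration
is justified by absolute convergence for `Re s > 1`, and the factor `1/n` in the Fourier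
coefficients raises the exponent from `s` to `s + 1`. -/
lemma integral_expZeta_mul_logTanUnit {s : ℂ} (hs : 1 < s.re) {ε : ℝ} {c : ℂ}
    (hc : ∀ n : ℕ, ∫ u in Ioo (0 : ℝ) 1, Complex.exp (2 * π * Complex.I * (ε * u : ℝ) * n) *
      (logTanUnit u : ℂ) = c * (oddHarmonic n / n)) :
    ∫ u in Ioo (0 : ℝ) 1, HurwitzZeta.expZeta ((ε * u : ℝ) : UnitAddCircle) s *
      (logTanUnit u : ℂ) = c * zetaH (s + 1) := by
  have hint (n : ℕ) : IntegrableOn (fun u : ℝ => Complex.exp (2 * π * Complex.I * (ε * u : ℝ) * n) /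
      (n : ℂ) ^ s * (logTanUnit u : ℂ)) (Ioo 0 1) :=
    integrableOn_mul_logTanUnit (C := 1 / (n : ℝ) ^ s.re)
      (Continuous.aestronglyMeasurable (by fun_prop))
      fun u _ => norm_exp_div_natCast_cpow_le (ε * u) n hs
  have h := hasSum_integral_of_summable_integral_norm hint ?_
  · have e (u : ℝ) : ∑' n : ℕ, Complex.exp (2 * π * Complex.I * (ε * u : ℝ) * n) / (n : ℂ) ^ s *
        (logTanUnit u : ℂ) = HurwitzZeta.expZeta ((ε * u : ℝ) : UnitAddCircle) s *
        (logTanUnit u : ℂ) :=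
      ((HurwitzZeta.hasSum_expZeta_of_one_lt_re (ε * u) hs).mul_right _).tsum_eq
    simp only [e] at h
    refine h.unique ?_
    have h2 := (hasSum_zetaH (s := s + 1) (by simpa using by linarith)).mul_left c
    refine h2.congr_fun fun n => ?_
    have e2 (u : ℝ) : Complex.exp (2 * π * Complex.I * (ε * u : ℝ) * n) / (n : ℂ) ^ s *
        (logTanUnit u : ℂ) = (1 / (n : ℂ) ^ s) * (Complex.exp (2 * π * Complex.I * (ε * u : ℝ) * n) *
        (logTanUnit u : ℂ)) := by ring
    simp only [e2]
    rw [integral_const_mul, hc]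
    rcases eq_or_ne n 0 with rfl | hn
    · simp [oddHarmonic_zero]
    · rw [Complex.cpow_add _ _ (by exact_mod_cast hn), Complex.cpow_one]
      field_simp
  · refine Summable.of_nonneg_of_le (fun n => integral_nonneg fun u => norm_nonneg _) (fun n => ?_)
      ((Real.summable_one_div_nat_rpow.2 hs).mul_right (∫ u in Ioo (0 : ℝ) 1, |logTanUnit u|))
    rw [← integral_const_mul]
    refine integral_mono (hint n).norm (integrableOn_logTanUnit.abs.const_mul _) fun u => ?_
    rw [norm_mul, Complex.norm_real, Real.norm_eq_abs]
    gcongr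
    exact norm_exp_div_natCast_cpow_le (ε * u) n hs

/-- Hurwitz's formula in the half-plane `Re z < 0`. -/
lemma hurwitzZeta_eq_expZeta {z : ℂ} (hz : z.re < 0) {u : ℝ} :
    HurwitzZeta.hurwitzZeta (u : UnitAddCircle) z =
      (2 * π : ℂ) ^ (-(1 - z)) * Complex.Gamma (1 - z) *
      (Complex.exp (-π * Complex.I * (1 - z) / 2) * HurwitzZeta.expZeta ((1 * u : ℝ)) (1 - z) +
        Complex.exp (π * Complex.I * (1 - z) / 2) *
          HurwitzZeta.expZeta ((-1 * u : ℝ)) (1 - z)) := by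
  have h := HurwitzZeta.hurwitzZeta_one_sub (u : UnitAddCircle) (s := 1 - z) (fun n h => by
    have := congrArg Complex.re h
    simp at this
    linarith [(n.cast_nonneg : (0 : ℝ) ≤ n)]) (Or.inr fun h => by
    have := congrArg Complex.re h
    simp at this
    linarith)
  rw [sub_sub_cancel] at h
  rw [h, one_mul, neg_one_mul, AddCircle.coe_neg]

lemma continuous_hurwitzZeta_param {z : ℂ} (hz : z.re < 0) :
    Continuous fun u : ℝ => HurwitzZeta.hurwitzZeta (u : UnitAddCircle) z := by
  have h := continuous_expZeta (s := 1 - z) (by simp; linarith)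
  have h1 := h.comp (continuous_const_mul (1 : ℝ))
  have h2 := h.comp (continuous_const_mul (-1 : ℝ))
  simp only [Function.comp_def] at h1 h2
  simp_rw [hurwitzZeta_eq_expZeta hz]
  fun_prop

/-- In Hurwitz's formula the prefactors are continuous, hence bounded on a closed ball, while both
periodic series are at most `∑ n^{-(1+r)}` because `Re z ≤ -r` there. -/
lemma exists_norm_hurwitzZeta_le_of_re_neg {z₀ : ℂ} (hz₀ : z₀.re < 0) :
    ∃ r > 0, ∃ C : ℝ, ∀ z ∈ Metric.ball z₀ r, ∀ u ∈ Ioo (0 : ℝ) 1,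
      ‖HurwitzZeta.hurwitzZeta (u : UnitAddCircle) z‖ ≤ C := by
  set r := -z₀.re / 2 with hr
  have hr0 : 0 < r := by linarith
  have hre : ∀ z ∈ Metric.closedBall z₀ r, z.re ≤ -r := by
    intro z hz
    have h1 := (Complex.abs_re_le_norm (z - z₀)).trans (by simpa [dist_eq_norm] using hz)
    rw [Complex.sub_re] at h1
    linarith [(abs_le.1 h1).2]
  have hcont : ContinuousOn (fun z : ℂ => ‖(2 * π : ℂ) ^ (-(1 - z)) * Complex.Gamma (1 - z)‖ *
      (‖Complex.exp (-π * Complex.I * (1 - z) / 2)‖ + ‖Complex.exp (π * Complex.I * (1 - z) / 2)‖))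
      (Metric.closedBall z₀ r) := by
    have h2pi : (2 * π : ℂ) ≠ 0 := by exact_mod_cast Real.two_pi_pos.ne'
    refine ContinuousOn.mul (ContinuousOn.norm (ContinuousOn.mul ?_ ?_)) (by fun_prop)
    · exact ContinuousOn.const_cpow (by fun_prop) (Or.inl h2pi)
    · intro z hz
      refine ContinuousAt.continuousWithinAt ?_
      refine ContinuousAt.comp (f := fun z : ℂ => 1 - z) (g := Complex.Gamma)
        (Complex.differentiableAt_Gamma _ fun n h => ?_).continuousAt (by fun_prop)
      have := congrArg Complex.re h
      simp at this
      linarith [(n.cast_nonneg : (0 : ℝ) ≤ n), hre z hz]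
  obtain ⟨M, hM⟩ := (isCompact_closedBall z₀ r).exists_bound_of_continuousOn hcont
  refine ⟨r, hr0, M * ∑' n : ℕ, 1 / (n : ℝ) ^ (1 + r), fun z hz u hu => ?_⟩
  have hz' := Metric.ball_subset_closedBall hz
  have hzr := hre z hz'
  have hE (a : ℝ) := norm_expZeta_le a (s := 1 - z) (σ := 1 + r) (by linarith)
    (by simp; linarith)
  have hZ : 0 ≤ ∑' n : ℕ, 1 / (n : ℝ) ^ (1 + r) := (norm_nonneg _).trans (hE 0)
  rw [hurwitzZeta_eq_expZeta (by linarith), norm_mul]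
  calc _ ≤ ‖(2 * π : ℂ) ^ (-(1 - z)) * Complex.Gamma (1 - z)‖ *
      (‖Complex.exp (-π * Complex.I * (1 - z) / 2)‖ * (∑' n : ℕ, 1 / (n : ℝ) ^ (1 + r)) +
       ‖Complex.exp (π * Complex.I * (1 - z) / 2)‖ * (∑' n : ℕ, 1 / (n : ℝ) ^ (1 + r))) := by
        gcongr
        refine (norm_add_le _ _).trans ?_
        rw [norm_mul, norm_mul]
        gcongr
        · exact hE _
        · exact hE _
    _ = (‖(2 * π : ℂ) ^ (-(1 - z)) * Complex.Gamma (1 - z)‖ *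
      (‖Complex.exp (-π * Complex.I * (1 - z) / 2)‖ + ‖Complex.exp (π * Complex.I * (1 - z) / 2)‖))
       * ∑' n : ℕ, 1 / (n : ℝ) ^ (1 + r) := by ring
    _ ≤ _ := by
        gcongr
        exact (le_abs_self _).trans (hM z hz')

/-- The Mellin-type integral of the Hurwitz zeta function for `Re z < 0`. -/
lemma integral_hurwitzZeta_mul_logTanUnit_of_re_neg {z : ℂ} (hz : z.re < 0) :
    ∫ u in Ioo (0 : ℝ) 1, HurwitzZeta.hurwitzZeta (u : UnitAddCircle) z * (logTanUnit u : ℂ) =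
      -(4 / π) * ((2 * π : ℂ) ^ (z - 1) * Complex.Gamma (1 - z) * Complex.cos (π * z / 2) *
        zetaH (2 - z)) := by
  have hs : 1 < (1 - z).re := by simp; linarith
  have hi (ε : ℝ) : IntegrableOn (fun u : ℝ => HurwitzZeta.expZeta ((ε * u : ℝ) : UnitAddCircle)
      (1 - z) * (logTanUnit u : ℂ)) (Ioo 0 1) :=
    integrableOn_mul_logTanUnit
      ((continuous_expZeta hs).comp (continuous_const_mul ε)).aestronglyMeasurable
      fun u _ => norm_expZeta_le _ hs le_rfl
  have h1 := integral_expZeta_mul_logTanUnit hs (ε := 1) (c := -(2 * Complex.I / π)) fun n => by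
    simpa using integral_exp_mul_logTanUnit n
  have h2 := integral_expZeta_mul_logTanUnit hs (ε := -1) (c := 2 * Complex.I / π) fun n => by
    simpa using integral_exp_neg_mul_logTanUnit n
  simp_rw [hurwitzZeta_eq_expZeta hz, mul_assoc _ _ ((logTanUnit _ : ℝ) : ℂ), add_mul,
    mul_assoc _ _ ((logTanUnit _ : ℝ) : ℂ)]
  rw [integral_const_mul, integral_add ((hi 1).const_mul _) ((hi (-1)).const_mul _),
    integral_const_mul, integral_const_mul, h1, h2]
  -- The Fourier constants at `±u` are opposite, so the two phase factors combine into `sin(π(1 -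
  -- z)/2) = cos(πz/2)`.
  have hcos : Complex.cos (π * z / 2) =
      (Complex.exp (π * Complex.I * (1 - z) / 2) - Complex.exp (-π * Complex.I * (1 - z) / 2)) /
        (2 * Complex.I) := by
    rw [show (π * z / 2 : ℂ) = π / 2 - π * (1 - z) / 2 by ring, Complex.cos_pi_div_two_sub,
      Complex.sin]
    rw [show -(π * (1 - z) / 2 : ℂ) * Complex.I = -π * Complex.I * (1 - z) / 2 by ring,
      show (π * (1 - z) / 2 : ℂ) * Complex.I = π * Complex.I * (1 - z) / 2 by ring]
    field_simp
    rw [Complex.I_sq]; ring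
  rw [hcos, show -(1 - z) = z - 1 by ring, show 1 - z + 1 = 2 - z by ring]
  have hp : (π : ℂ) ≠ 0 := by exact_mod_cast Real.pi_ne_zero
  field_simp
  rw [Complex.I_sq]
  ring

/-! ### The Hurwitz zeta function for `Re z > -1` by linear interpolation. -/

/-- The error of linear interpolation on the unit interval. -/
lemma norm_sub_linear_interpolation_le {g g' g'' : ℝ → ℂ} {B : ℝ}
    (hg : ∀ t ∈ Icc (0 : ℝ) 1, HasDerivAt g (g' t) t)
    (hg' : ∀ t ∈ Icc (0 : ℝ) 1, HasDerivAt g' (g'' t) t)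
    (hB : ∀ t ∈ Icc (0 : ℝ) 1, ‖g'' t‖ ≤ B) {u : ℝ} (hu : u ∈ Icc (0 : ℝ) 1) :
    ‖g u - (1 - u) * g 0 - u * g 1‖ ≤ 2 * B := by
  have h0 : (0 : ℝ) ∈ Icc (0 : ℝ) 1 := by simp
  have h1 : (1 : ℝ) ∈ Icc (0 : ℝ) 1 := by simp
  have hB0 : 0 ≤ B := (norm_nonneg _).trans (hB 0 h0)
  have key1 : ∀ t ∈ Icc (0 : ℝ) 1, ‖g' t - g' 0‖ ≤ B := fun t ht => by
    have := (convex_Icc (0 : ℝ) 1).norm_image_sub_le_of_norm_hasDerivWithin_le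
      (fun x hx => (hg' x hx).hasDerivWithinAt) hB h0 ht
    refine this.trans (mul_le_of_le_one_right hB0 ?_)
    rw [sub_zero, Real.norm_of_nonneg ht.1]; exact ht.2
  have key2 : ∀ t ∈ Icc (0 : ℝ) 1, ‖(g t - t * g' 0) - g 0‖ ≤ B := fun t ht => by
    have hd : ∀ x ∈ Icc (0 : ℝ) 1, HasDerivWithinAt (fun t : ℝ => g t - t * g' 0) (g' x - g' 0)
        (Icc 0 1) x := fun x hx => by
      have := (hg x hx).sub (((hasDerivAt_id x).ofReal_comp).mul_const (g' 0))
      simp only [Complex.ofReal_one, one_mul, id] at this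
      exact this.hasDerivWithinAt
    have := (convex_Icc (0 : ℝ) 1).norm_image_sub_le_of_norm_hasDerivWithin_le hd key1 h0 ht
    simp only [Complex.ofReal_zero, zero_mul, sub_zero] at this
    refine this.trans (mul_le_of_le_one_right hB0 ?_)
    rw [Real.norm_of_nonneg ht.1]; exact ht.2
  -- Interpolation is exact on affine functions, so `g` may be replaced by its remainder after the
  -- tangent at `0`.
  have e : g u - (1 - u) * g 0 - u * g 1 =
      ((g u - u * g' 0) - g 0) - u * ((g 1 - (1 : ℝ) * g' 0) - g 0) := by
    push_cast; ring
  rw [e]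
  refine (norm_sub_le _ _).trans ?_
  rw [norm_mul, Complex.norm_real, Real.norm_of_nonneg hu.1]
  nlinarith [key2 u hu, key2 1 h1, hu.1, hu.2, norm_nonneg ((g 1 - (1 : ℝ) * g' 0) - g 0)]

/-- The error of linear interpolation of `t ↦ (n + 1 + t) ^ (-z)` between `t = 0` and `t = 1`. -/
noncomputable def cpowDefect (z : ℂ) (u : ℝ) (n : ℕ) : ℂ :=
  ((n + 1 + u : ℝ) : ℂ) ^ (-z) - (1 - u) * ((n + 1 : ℝ) : ℂ) ^ (-z)
    - u * ((n + 2 : ℝ) : ℂ) ^ (-z)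

lemma hasDerivAt_ofReal_add_cpow (w : ℂ) {N t : ℝ} (h : 0 < N + t) :
    HasDerivAt (fun t : ℝ => ((N + t : ℝ) : ℂ) ^ w) (w * ((N + t : ℝ) : ℂ) ^ (w - 1)) t := by
  have h1 := ((hasDerivAt_id (t : ℂ)).const_add (N : ℂ)).cpow_const (c := w)
    (Or.inl (by simpa using h))
  simpa using h1.comp_ofReal

/-- Interpolation error is governed by the second derivative, which improves the decay from `n^{-Re
z}` to `n^{-Re z - 2}`. The defects are therefore summable for `Re z > -1`, a half-plane overlapping
the region of Hurwitz's formula. -/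
lemma norm_cpowDefect_le {z : ℂ} (hz : -1 < z.re) {u : ℝ} (hu : u ∈ Icc (0 : ℝ) 1) (n : ℕ) :
    ‖cpowDefect z u n‖ ≤ 2 * (‖z‖ * ‖z + 1‖ * ((n : ℝ) + 1) ^ (-z.re - 2)) := by
  have hn : (0 : ℝ) < n + 1 := by positivity
  have hpos : ∀ t ∈ Icc (0 : ℝ) 1, (0 : ℝ) < n + 1 + t := fun t ht => by linarith [ht.1]
  have h := norm_sub_linear_interpolation_le
    (g := fun t : ℝ => ((n + 1 + t : ℝ) : ℂ) ^ (-z))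
    (g' := fun t : ℝ => -z * ((n + 1 + t : ℝ) : ℂ) ^ (-z - 1))
    (g'' := fun t : ℝ => -z * ((-z - 1) * ((n + 1 + t : ℝ) : ℂ) ^ (-z - 1 - 1)))
    (B := ‖z‖ * ‖z + 1‖ * ((n : ℝ) + 1) ^ (-z.re - 2))
    (fun t ht => hasDerivAt_ofReal_add_cpow _ (hpos t ht))
    (fun t ht => (hasDerivAt_ofReal_add_cpow _ (hpos t ht)).const_mul _) ?_ hu
  · rw [cpowDefect]
    convert h using 3
    · simp
    · norm_num [add_assoc]
  · intro t ht
    rw [norm_mul, norm_mul, norm_neg, show -z - 1 = -(z + 1) by ring, norm_neg,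
      Complex.norm_cpow_eq_rpow_re_of_pos (hpos t ht), mul_assoc]
    have e : (-(z + 1) - 1).re = -z.re - 2 := by simp; ring
    rw [e]
    gcongr ‖z‖ * (‖z + 1‖ * ?_)
    exact Real.rpow_le_rpow_of_nonpos hn (by linarith [ht.1]) (by linarith)

lemma norm_cpowDefect_le_of_bounds {ρ M : ℝ} (hρ : 0 < ρ) {z : ℂ} (hz : -1 + ρ ≤ z.re)
    (hM : ‖z‖ ≤ M) {u : ℝ} (hu : u ∈ Icc (0 : ℝ) 1) (n : ℕ) :
    ‖cpowDefect z u n‖ ≤ 2 * (M * (M + 1) * ((n : ℝ) + 1) ^ (-1 - ρ)) := by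
  refine (norm_cpowDefect_le (by linarith) hu n).trans ?_
  have h1 : ‖z + 1‖ ≤ M + 1 := (norm_add_le _ _).trans (by simpa using hM)
  have hM0 : 0 ≤ M := (norm_nonneg z).trans hM
  have h2 : ((n : ℝ) + 1) ^ (-z.re - 2) ≤ ((n : ℝ) + 1) ^ (-1 - ρ) :=
    Real.rpow_le_rpow_of_exponent_le (by linarith [(n.cast_nonneg : (0 : ℝ) ≤ n)]) (by linarith)
  gcongr

lemma summable_add_one_rpow {ρ : ℝ} (hρ : 0 < ρ) (C : ℝ) :
    Summable fun n : ℕ => 2 * (C * ((n : ℝ) + 1) ^ (-1 - ρ)) := by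
  have := (summable_nat_add_iff 1).2 (Real.summable_nat_rpow.2 (show -1 - ρ < -1 by linarith))
  simpa using (this.mul_left C).mul_left 2

lemma differentiableOn_tsum_cpowDefect {u : ℝ} (hu : u ∈ Icc (0 : ℝ) 1) :
    DifferentiableOn ℂ (fun z => ∑' n, cpowDefect z u n) {z | -1 < z.re} := by
  intro z hz
  set ρ := (z.re + 1) / 2 with hρ
  have hz' : -1 < z.re := hz
  have hρ0 : 0 < ρ := by linarith
  -- On this neighbourhood both `Re w` and `‖w‖` are controlled, which gives the uniform majorant
  -- for the Weierstrass test.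
  set V : Set ℂ := {w | -1 + ρ < w.re} ∩ Metric.ball 0 (‖z‖ + 1) with hV
  have hVo : IsOpen V := (isOpen_lt continuous_const Complex.continuous_re).inter Metric.isOpen_ball
  have hzV : z ∈ V := ⟨by simp only [mem_ofPred_eq]; linarith, by simp⟩
  refine DifferentiableAt.differentiableWithinAt ?_
  refine DifferentiableOn.differentiableAt (s := V) ?_ (hVo.mem_nhds hzV)
  refine Complex.differentiableOn_tsum_of_summable_norm
    (summable_add_one_rpow hρ0 ((‖z‖ + 1) * (‖z‖ + 1 + 1))) (fun n w _ => ?_) hVo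
    fun n w hw => norm_cpowDefect_le_of_bounds hρ0 (le_of_lt hw.1)
      (by simpa using (Metric.mem_ball.1 hw.2).le) hu n
  have hne (x : ℝ) (hx : 0 < x) : DifferentiableAt ℂ (fun w : ℂ => (x : ℂ) ^ (-w)) w :=
    DifferentiableAt.const_cpow (by fun_prop) (Or.inl (by exact_mod_cast hx.ne'))
  refine DifferentiableAt.differentiableWithinAt ?_
  exact ((hne _ (by linarith [hu.1, (n.cast_nonneg : (0 : ℝ) ≤ n)])).sub
    ((hne _ (by positivity)).const_mul _)).sub ((hne _ (by positivity)).const_mul _)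

/-- Without its first term `u^{-z}`, the Hurwitz series has as its interpolants a series with sum
`(1 - u) ζ(z) + u (ζ(z) - 1) = ζ(z) - u`; what remains is the sum of defects. -/
lemma hurwitzZeta_sub_riemannZeta_of_one_lt_re {z : ℂ} (hz : 1 < z.re) {u : ℝ}
    (hu : u ∈ Ioo (0 : ℝ) 1) :
    HurwitzZeta.hurwitzZeta (u : UnitAddCircle) z - riemannZeta z =
      (u : ℂ) ^ (-z) - u + ∑' n, cpowDefect z u n := by
  have h1 := HurwitzZeta.hasSum_hurwitzZeta_of_one_lt_re (Ioo_subset_Icc_self hu) hz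
  have hζ : HasSum (fun n : ℕ => ((n + 1 : ℝ) : ℂ) ^ (-z)) (riemannZeta z) := by
    have h := HurwitzZeta.hasSum_hurwitzZeta_of_one_lt_re (a := 1) (by simp) hz
    rw [AddCircle.coe_period, HurwitzZeta.hurwitzZeta_zero] at h
    refine h.congr_fun fun n => ?_
    rw [Complex.cpow_neg, one_div]
    push_cast
    rfl
  have h1' := (hasSum_nat_add_iff' 1).2 h1
  have hζ' := (hasSum_nat_add_iff' 1).2 hζ
  have h := (h1'.sub (hζ.mul_left (1 - u : ℂ))).sub (hζ'.mul_left (u : ℂ))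
  have h2 : HasSum (cpowDefect z u) _ := h.congr_fun fun n => by
    rw [cpowDefect, one_div, ← Complex.cpow_neg]
    push_cast
    ring_nf
  rw [h2.tsum_eq]
  simp [Complex.cpow_neg]
  ring

/-- Identity theorem: subtracting `ζ(z)` removes the pole at `1`, so both sides are analytic on the
whole half-plane. -/
lemma hurwitzZeta_sub_riemannZeta {z : ℂ} (hz : -1 < z.re) {u : ℝ} (hu : u ∈ Ioo (0 : ℝ) 1) :
    HurwitzZeta.hurwitzZeta (u : UnitAddCircle) z - riemannZeta z =
      (u : ℂ) ^ (-z) - u + ∑' n, cpowDefect z u n := by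
  have hU : IsOpen {z : ℂ | -1 < z.re} := isOpen_lt continuous_const Complex.continuous_re
  have h1 : AnalyticOnNhd ℂ (fun z => HurwitzZeta.hurwitzZeta (u : UnitAddCircle) z - riemannZeta z)
      {z | -1 < z.re} := by
    have := HurwitzZeta.differentiable_hurwitzZeta_sub_hurwitzZeta (u : UnitAddCircle) 0
    simp only [HurwitzZeta.hurwitzZeta_zero] at this
    exact this.differentiableOn.analyticOnNhd hU
  have h2 : AnalyticOnNhd ℂ (fun z => (u : ℂ) ^ (-z) - u + ∑' n, cpowDefect z u n)
      {z | -1 < z.re} := by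
    refine DifferentiableOn.analyticOnNhd (DifferentiableOn.add ?_
      (differentiableOn_tsum_cpowDefect (Ioo_subset_Icc_self hu))) hU
    refine DifferentiableOn.sub_const (DifferentiableOn.const_cpow (by fun_prop) (Or.inl ?_)) _
    exact_mod_cast hu.1.ne'
  refine h1.eqOn_of_preconnected_of_eventuallyEq h2 (z₀ := 2)
    (convex_halfSpace_re_gt (-1)).isPreconnected (by simp; norm_num) ?_ hz
  filter_upwards [(isOpen_lt continuous_const Complex.continuous_re).mem_nhds
    (show (1 : ℝ) < (2 : ℂ).re by norm_num)] with w hw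
  exact hurwitzZeta_sub_riemannZeta_of_one_lt_re hw hu

lemma continuousOn_tsum_cpowDefect {z : ℂ} (hz : -1 < z.re) :
    ContinuousOn (fun u => ∑' n, cpowDefect z u n) (Icc (0 : ℝ) 1) := by
  refine continuousOn_tsum (fun n => ?_)
    (summable_add_one_rpow (ρ := z.re + 1) (by linarith) (‖z‖ * (‖z‖ + 1)))
    fun n u hu => norm_cpowDefect_le_of_bounds (by linarith) (by linarith) le_rfl hu n
  unfold cpowDefect
  have : ContinuousOn (fun u : ℝ => ((n + 1 + u : ℝ) : ℂ) ^ (-z)) (Icc 0 1) := fun u hu =>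
    (hasDerivAt_ofReal_add_cpow _ (by linarith [hu.1, (n.cast_nonneg : (0 : ℝ) ≤ n)])
      ).continuousAt.continuousWithinAt
  fun_prop

lemma continuousOn_hurwitzZeta_param (z : ℂ) :
    ContinuousOn (fun u : ℝ => HurwitzZeta.hurwitzZeta (u : UnitAddCircle) z) (Ioo 0 1) := by
  rcases lt_or_ge (-1) z.re with h | h
  · have h1 : ContinuousOn (fun u : ℝ => ((u : ℂ) ^ (-z) - u + (∑' n, cpowDefect z u n)) + riemannZeta z)
        (Ioo 0 1) := by
      refine ContinuousOn.add (ContinuousOn.add (ContinuousOn.sub ?_ (by fun_prop))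
        ((continuousOn_tsum_cpowDefect h).mono Ioo_subset_Icc_self)) (by fun_prop)
      intro u hu
      have := hasDerivAt_ofReal_add_cpow (-z) (N := 0) (t := u) (by linarith [hu.1])
      simp only [zero_add] at this
      exact this.continuousAt.continuousWithinAt
    refine h1.congr fun u hu => ?_
    dsimp only
    rw [← hurwitzZeta_sub_riemannZeta h hu, sub_add_cancel]
  · exact (continuous_hurwitzZeta_param (by linarith)).continuousOn

/-- Locally uniform bound for the Hurwitz zeta function in the half-plane `Re z < 1`. -/
lemma exists_norm_hurwitzZeta_le {z₀ : ℂ} (hz₀ : z₀.re < 1) :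
    ∃ r > 0, ∃ C σ : ℝ, σ < 1 ∧ ∀ z ∈ Metric.ball z₀ r, ∀ u ∈ Ioo (0 : ℝ) 1,
      ‖HurwitzZeta.hurwitzZeta (u : UnitAddCircle) z‖ ≤ C * u ^ (-σ) := by
  rcases lt_or_ge z₀.re 0 with h | h
  · obtain ⟨r, hr, C, hC⟩ := exists_norm_hurwitzZeta_le_of_re_neg h
    exact ⟨r, hr, C, 0, one_pos, fun z hz u hu => by simpa using hC z hz u hu⟩
  -- Half the distance to the line `Re z = 1`: the exponent `σ = Re z₀ + r` dominates `Re z` on the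
  -- ball and is still below `1`. Since `0 ≤ Re z₀`, also `r ≤ 1/2`, so `Re z ≥ -1 + r` there.
  · set r := (1 - z₀.re) / 2 with hr
    have hr0 : 0 < r := by linarith
    set σ := z₀.re + r with hσ
    have hre : ∀ z ∈ Metric.closedBall z₀ r, |z.re - z₀.re| ≤ r := by
      intro z hz
      rw [← Complex.sub_re]
      exact (Complex.abs_re_le_norm (z - z₀)).trans (by simpa [dist_eq_norm] using hz)
    have hcont : ContinuousOn riemannZeta (Metric.closedBall z₀ r) := fun z hz =>
      (differentiableAt_riemannZeta fun h1 => by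
        have := (abs_le.1 (hre z hz)).2
        rw [h1, Complex.one_re] at this
        linarith).continuousAt.continuousWithinAt
    obtain ⟨Z, hZ⟩ := (isCompact_closedBall z₀ r).exists_bound_of_continuousOn hcont
    set S := ∑' n : ℕ, 2 * ((‖z₀‖ + r) * (‖z₀‖ + r + 1) * ((n : ℝ) + 1) ^ (-1 - r)) with hS
    refine ⟨r, hr0, Z + 1 + 1 + S, σ, by linarith, fun z hz u hu => ?_⟩
    have hz' := Metric.ball_subset_closedBall hz
    have hrz := abs_le.1 (hre z hz')
    have hnz : ‖z‖ ≤ ‖z₀‖ + r := by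
      have := norm_le_norm_add_norm_sub' z z₀
      have h2 : ‖z - z₀‖ ≤ r := by simpa [dist_eq_norm] using hz'
      linarith
    have hT : ‖∑' n, cpowDefect z u n‖ ≤ S :=
      tsum_of_norm_bounded (summable_add_one_rpow hr0 _).hasSum
        (norm_cpowDefect_le_of_bounds hr0 (by linarith) hnz (Ioo_subset_Icc_self hu))
    have h1 : 1 ≤ u ^ (-σ) :=
      Real.one_le_rpow_of_pos_of_le_one_of_nonpos hu.1 hu.2.le (by linarith)
    have h2 : u ^ (-z.re) ≤ u ^ (-σ) :=
      Real.rpow_le_rpow_of_exponent_ge hu.1 hu.2.le (by linarith)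
    have hζ := hZ z hz'
    have hu' : ‖(u : ℂ)‖ ≤ 1 := by
      rw [Complex.norm_real, Real.norm_of_nonneg hu.1.le]; exact hu.2.le
    have hp : ‖(u : ℂ) ^ (-z)‖ = u ^ (-z.re) := by
      rw [Complex.norm_cpow_eq_rpow_re_of_pos hu.1, Complex.neg_re]
    have hZ0 : 0 ≤ Z := (norm_nonneg _).trans hζ
    have hS0 : 0 ≤ S := (norm_nonneg _).trans hT
    have e := hurwitzZeta_sub_riemannZeta (z := z) (by linarith) hu
    rw [sub_eq_iff_eq_add] at e
    rw [e]
    calc _ ≤ ‖(u : ℂ) ^ (-z)‖ + ‖(u : ℂ)‖ + ‖∑' n, cpowDefect z u n‖ + ‖riemannZeta z‖ := by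
          refine (norm_add_le _ _).trans ?_
          gcongr
          refine (norm_add_le _ _).trans ?_
          gcongr
          exact norm_sub_le _ _
      _ ≤ u ^ (-σ) + 1 + S + Z := by rw [hp]; gcongr
      _ ≤ _ := by nlinarith

/-! ### The log-tangent integral as an analytic function on `Re z < 1`. -/

/-- The integral of `ζ(z, u) log tan (π u / 2)` over the unit interval. -/
noncomputable def logTanMellin (z : ℂ) : ℂ :=
  ∫ u in Ioo (0 : ℝ) 1, HurwitzZeta.hurwitzZeta (u : UnitAddCircle) z * (logTanUnit u : ℂ)

lemma isOpen_re_lt_one : IsOpen {z : ℂ | z.re < 1} :=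
  isOpen_lt Complex.continuous_re continuous_const

lemma aestronglyMeasurable_hurwitzZeta_mul_logTanUnit (z : ℂ) :
    AEStronglyMeasurable (fun u : ℝ => HurwitzZeta.hurwitzZeta (u : UnitAddCircle) z *
      (logTanUnit u : ℂ)) (volume.restrict (Ioo 0 1)) :=
  ((continuousOn_hurwitzZeta_param z).aestronglyMeasurable measurableSet_Ioo).mul
    (by fun_prop)

lemma exists_integrable_bound_hurwitzZeta_mul_logTanUnit {z₀ : ℂ} (hz₀ : z₀.re < 1) :
    ∃ r > 0, ∃ g : ℝ → ℝ, Integrable g (volume.restrict (Ioo 0 1)) ∧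
      ∀ᵐ (u : ℝ) ∂(volume.restrict (Ioo 0 1)), ∀ z ∈ Metric.ball z₀ r,
        ‖HurwitzZeta.hurwitzZeta (u : UnitAddCircle) z * (logTanUnit u : ℂ)‖ ≤ g u := by
  obtain ⟨r, hr, C, σ, hσ, hC⟩ := exists_norm_hurwitzZeta_le hz₀
  refine ⟨r, hr, _, (integrableOn_rpow_mul_logTanUnit hσ).const_mul C, ?_⟩
  filter_upwards [ae_restrict_mem measurableSet_Ioo] with u hu z hz
  rw [norm_mul, Complex.norm_real, Real.norm_eq_abs, ← mul_assoc]
  gcongr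
  exact hC z hz u hu

lemma integrableOn_hurwitzZeta_mul_logTanUnit {z : ℂ} (hz : z.re < 1) :
    IntegrableOn (fun u : ℝ => HurwitzZeta.hurwitzZeta (u : UnitAddCircle) z *
      (logTanUnit u : ℂ)) (Ioo 0 1) := by
  obtain ⟨r, hr, g, hg, hb⟩ := exists_integrable_bound_hurwitzZeta_mul_logTanUnit hz
  refine hg.mono' (aestronglyMeasurable_hurwitzZeta_mul_logTanUnit z) ?_
  filter_upwards [hb] with u hu using hu z (Metric.mem_ball_self hr)

lemma differentiableAt_hurwitzZeta_of_re_lt_one (a : UnitAddCircle) {z : ℂ} (hz : z.re < 1) :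
    DifferentiableAt ℂ (HurwitzZeta.hurwitzZeta a) z :=
  HurwitzZeta.differentiableAt_hurwitzZeta a fun h => by simp [h] at hz

lemma hasDerivAt_logTanMellin {z : ℂ} (hz : z.re < 1) :
    IntegrableOn (fun u : ℝ => deriv (HurwitzZeta.hurwitzZeta (u : UnitAddCircle)) z *
      (logTanUnit u : ℂ)) (Ioo 0 1) ∧
    HasDerivAt logTanMellin (∫ u in Ioo (0 : ℝ) 1,
      deriv (HurwitzZeta.hurwitzZeta (u : UnitAddCircle)) z * (logTanUnit u : ℂ)) z := by
  have h := hasDerivAt_integral_of_locally_dominated (μ := volume.restrict (Ioo (0 : ℝ) 1))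
    isOpen_re_lt_one (F := fun z (u : ℝ) => HurwitzZeta.hurwitzZeta (u : UnitAddCircle) z *
      (logTanUnit u : ℂ)) (fun z _ => aestronglyMeasurable_hurwitzZeta_mul_logTanUnit z)
    (Eventually.of_forall fun u z hz =>
      ((differentiableAt_hurwitzZeta_of_re_lt_one _ hz).mul_const _).differentiableWithinAt)
    (fun z₀ hz₀ => exists_integrable_bound_hurwitzZeta_mul_logTanUnit hz₀) hz
  simp only [deriv_mul_const (differentiableAt_hurwitzZeta_of_re_lt_one _ hz)] at h
  exact h

lemma analyticOnNhd_logTanMellin : AnalyticOnNhd ℂ logTanMellin {z | z.re < 1} :=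
  DifferentiableOn.analyticOnNhd (fun _ hz =>
    (hasDerivAt_logTanMellin hz).2.differentiableAt.differentiableWithinAt) isOpen_re_lt_one

/-- The cosine is kept apart from this factor because it alone vanishes at the points `1 - 2n` used
later. -/
lemma differentiableAt_two_pi_cpow_mul_Gamma_mul_zetaH {z : ℂ} (hz : z.re < 1) :
    DifferentiableAt ℂ (fun z : ℂ => (2 * π : ℂ) ^ (z - 1) * Complex.Gamma (1 - z) *
      zetaH (2 - z)) z := by
  have h2pi : (2 * π : ℂ) ≠ 0 := by exact_mod_cast Real.two_pi_pos.ne'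
  refine DifferentiableAt.mul (DifferentiableAt.mul ?_ ?_) ?_
  · exact DifferentiableAt.const_cpow (by fun_prop) (Or.inl h2pi)
  · refine DifferentiableAt.comp (f := fun z : ℂ => 1 - z) (g := Complex.Gamma) _
      (Complex.differentiableAt_Gamma _ fun n h => ?_) (by fun_prop)
    have := congrArg Complex.re h
    simp at this
    linarith [(n.cast_nonneg : (0 : ℝ) ≤ n)]
  · refine DifferentiableAt.comp (f := fun z : ℂ => 2 - z) (g := zetaH) _
      (analyticOnNhd_zetaH _ ?_).differentiableAt (by fun_prop)
    simp; linarith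

/-- Evaluation of the log-tangent integral of the Hurwitz zeta function for `Re z < 1`. -/
lemma logTanMellin_eq {z : ℂ} (hz : z.re < 1) :
    logTanMellin z = -(4 / π) * ((2 * π : ℂ) ^ (z - 1) * Complex.Gamma (1 - z) * zetaH (2 - z) *
      Complex.cos (π * z / 2)) := by
  have h2 : AnalyticOnNhd ℂ (fun z : ℂ => -(4 / π : ℂ) * ((2 * π : ℂ) ^ (z - 1) *
      Complex.Gamma (1 - z) * zetaH (2 - z) * Complex.cos (π * z / 2))) {z | z.re < 1} := by
    refine DifferentiableOn.analyticOnNhd (fun w hw => ?_) isOpen_re_lt_one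
    exact (((differentiableAt_two_pi_cpow_mul_Gamma_mul_zetaH hw).mul
      (by fun_prop)).const_mul _).differentiableWithinAt
  refine analyticOnNhd_logTanMellin.eqOn_of_preconnected_of_eventuallyEq h2 (z₀ := -1)
    (convex_halfSpace_re_lt 1).isPreconnected (by simp) ?_ hz
  filter_upwards [(isOpen_lt Complex.continuous_re continuous_const).mem_nhds
    (show (-1 : ℂ).re < (0 : ℝ) by norm_num)] with w hw
  rw [logTanMellin, integral_hurwitzZeta_mul_logTanUnit_of_re_neg hw]
  ring

/-! ### Solving for `ζ_h` at generic points and at odd integers. -/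

lemma cos_pi_mul_div_two_ne_zero {s : ℂ} (hs : 1 < s.re) (hodd : ∀ n : ℕ, s ≠ 2 * n + 1) :
    Complex.cos (π * s / 2) ≠ 0 := by
  intro h
  obtain ⟨k, hk⟩ := Complex.cos_eq_zero_iff.1 h
  have hp : (π : ℂ) ≠ 0 := by exact_mod_cast Real.pi_ne_zero
  have hs2 : s = 2 * k + 1 := by
    field_simp at hk
    exact hk
  have hk0 : 0 ≤ k := by
    have := congrArg Complex.re hs2
    simp at this
    have h3 : (0 : ℝ) < k := by linarith
    exact_mod_cast h3.le
  lift k to ℕ using hk0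
  exact hodd k (by simpa using hs2)

lemma zetaH_eq_logTanMellin {s : ℂ} (hs : 1 < s.re) (hodd : ∀ n : ℕ, s ≠ 2 * n + 1) :
    zetaH s = (2 * π : ℂ) ^ (s - 1) / (2 * Complex.Gamma (s - 1) * Complex.cos (π * s / 2)) *
      (π / 2 * logTanMellin (2 - s)) := by
  have hcos := cos_pi_mul_div_two_ne_zero hs hodd
  have hΓ : Complex.Gamma (s - 1) ≠ 0 := Complex.Gamma_ne_zero_of_re_pos (by simpa using hs)
  have hp : (π : ℂ) ≠ 0 := by exact_mod_cast Real.pi_ne_zero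
  have h2pi : (2 * π : ℂ) ≠ 0 := mul_ne_zero two_ne_zero hp
  have hpow : (2 * π : ℂ) ^ (s - 1) ≠ 0 := by simp [Complex.cpow_eq_zero_iff, hp]
  rw [logTanMellin_eq (by simp; linarith), show (2 - s - 1 : ℂ) = -(s - 1) by ring,
    Complex.cpow_neg, show (1 - (2 - s) : ℂ) = s - 1 by ring, sub_sub_cancel,
    show (π * (2 - s) / 2 : ℂ) = π - π * s / 2 by ring, Complex.cos_pi_sub]
  field_simp
  norm_num

/-- Since `cos(πz/2)` vanishes at `z = 1 - 2n`, the product rule leaves only its derivative `-(-1)^n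
π/2` times the other factor, which contains `ζ_h(2n + 1)`. -/
lemma zetaH_two_mul_add_one {n : ℕ} (hn : 1 ≤ n) :
    zetaH (2 * n + 1) = (-1) ^ n * 2 ^ (2 * n) * (π : ℂ) ^ (2 * n - 1) /
      ((2 * n - 1).factorial : ℂ) * (π / 2 * ∫ u in Ioo (0 : ℝ) 1,
        deriv (HurwitzZeta.hurwitzZeta (u : UnitAddCircle)) (1 - 2 * n) * (logTanUnit u : ℂ)) := by
  have hp : (π : ℂ) ≠ 0 := by exact_mod_cast Real.pi_ne_zero
  have hre : (1 - 2 * n : ℂ).re < 1 := by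
    simp; omega
  have h1 := (hasDerivAt_logTanMellin hre).2
  set z₀ : ℂ := 1 - 2 * n with hz₀
  have hcosd : HasDerivAt (fun z : ℂ => Complex.cos (π * z / 2)) (-(-1) ^ n * (π / 2)) z₀ := by
    have := (((hasDerivAt_id z₀).const_mul (π : ℂ)).div_const 2).ccos
    refine this.congr_deriv ?_
    simp only [id, hz₀]
    rw [show (π * (1 - 2 * n) / 2 : ℂ) = π / 2 - n * π by ring, Complex.sin_pi_div_two_sub,
      show (n * π : ℂ) = ((n * π : ℝ) : ℂ) by push_cast; rfl, ← Complex.ofReal_cos,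
      Real.cos_nat_mul_pi]
    push_cast
    ring
  have hcos0 : Complex.cos (π * z₀ / 2) = 0 := by
    rw [hz₀, show (π * (1 - 2 * n) / 2 : ℂ) = π / 2 - n * π by ring, Complex.cos_pi_div_two_sub,
      Complex.sin_nat_mul_pi]
  have h2 := (((differentiableAt_two_pi_cpow_mul_Gamma_mul_zetaH hre).hasDerivAt.mul
    hcosd).const_mul (-(4 / π : ℂ)))
  have h3 : HasDerivAt logTanMellin _ z₀ := h2.congr_of_eventuallyEq (by
    filter_upwards [isOpen_re_lt_one.mem_nhds hre] with z hz
    exact logTanMellin_eq hz)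
  rw [h1.unique h3, hcos0, hz₀]
  -- Removes the truncated subtraction in `2 * n - 1`.
  obtain ⟨m, rfl⟩ : ∃ m, n = m + 1 := ⟨n - 1, by omega⟩
  have e1 : (1 - 2 * ((m + 1 : ℕ) : ℂ) - 1) = -((2 * m + 2 : ℕ) : ℂ) := by push_cast; ring
  have e2 : (1 - (1 - 2 * ((m + 1 : ℕ) : ℂ))) = ((2 * m + 1 : ℕ) : ℂ) + 1 := by push_cast; ring
  have e3 : (2 - (1 - 2 * ((m + 1 : ℕ) : ℂ))) = 2 * ((m + 1 : ℕ) : ℂ) + 1 := by push_cast; ring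
  rw [e1, e2, e3, Complex.Gamma_nat_eq_factorial, Complex.cpow_neg, Complex.cpow_natCast,
    show 2 * (m + 1) - 1 = 2 * m + 1 by omega, show 2 * (m + 1) = 2 * m + 2 by ring]
  have hf : ((2 * m + 1).factorial : ℂ) ≠ 0 := by exact_mod_cast Nat.factorial_ne_zero _
  have hs : ((-1 : ℂ) ^ (m + 1)) ^ 2 = 1 := by rw [← pow_mul, mul_comm, pow_mul]; simp
  rw [mul_pow]
  field_simp
  linear_combination (-(zetaH (2 * ((m + 1 : ℕ) : ℂ) + 1)) * 4 * ((2 * m + 1).factorial : ℂ) *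
    (π : ℂ) ^ (2 * m + 2)) * hs

/-! ### Fourier expansion and the Laplace transform of `log tan (π u / 2)`. -/

/-- The Fourier coefficients of a function on the unit interval. -/
noncomputable def unitFourierCoeff (f : ℝ → ℂ) (n : ℤ) : ℂ :=
  ∫ u in (0 : ℝ)..1, Complex.exp (-(2 * π * Complex.I * n * u)) * f u

lemma hasSum_unitFourierCoeff {f : ℝ → ℂ} (hf : Continuous f) (h01 : f 0 = f 1)
    (hs : Summable (unitFourierCoeff f)) {u : ℝ} (hu : u ∈ Ico (0 : ℝ) 1) :
    HasSum (fun n : ℤ => unitFourierCoeff f n * Complex.exp (2 * π * Complex.I * n * u)) (f u) := by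
  let B : C(UnitAddCircle, ℂ) := ContinuousMap.mk (AddCircle.liftIco 1 0 f)
    (AddCircle.liftIco_zero_continuous h01 hf.continuousOn)
  have hB : ∀ n : ℤ, fourierCoeff B n = unitFourierCoeff f n := by
    intro n
    rw [ContinuousMap.coe_mk, fourierCoeff_eq_intervalIntegral _ _ 0, unitFourierCoeff, div_one,
      one_smul, zero_add]
    refine intervalIntegral.integral_congr_Ioo_of_le zero_le_one fun x hx => ?_
    rw [AddCircle.liftIco_zero_coe_apply (Ioo_subset_Ico_self hx), fourier_coe_apply, smul_eq_mul]
    congr 2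
    push_cast
    ring
  have h := has_pointwise_sum_fourier_series_of_summable (hs.congr fun n => (hB n).symm) u
  simp_rw [hB] at h
  rw [ContinuousMap.coe_mk, AddCircle.liftIco_zero_coe_apply hu] at h
  refine h.congr_fun fun n => ?_
  rw [fourier_coe_apply, smul_eq_mul]
  simp

/-- A Parseval identity: the absolutely convergent Fourier series of `f` is integrated term by term.
Frequencies `n` and `-n` are paired, and the coefficients of `log tan` have opposite signs there. -/
lemma hasSum_integral_mul_logTanUnit {f : ℝ → ℂ} (hf : Continuous f) (h01 : f 0 = f 1)
    (hs : Summable (unitFourierCoeff f)) :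
    HasSum (fun n : ℕ => -(2 * Complex.I / π) * (oddHarmonic n / n) *
      (unitFourierCoeff f n - unitFourierCoeff f (-n)))
      (∫ u in Ioo (0 : ℝ) 1, f u * (logTanUnit u : ℂ)) := by
  have hnorm (n : ℤ) (u : ℝ) : ‖unitFourierCoeff f n * Complex.exp (2 * π * Complex.I * n * u)‖ =
      ‖unitFourierCoeff f n‖ := by
    rw [norm_mul, show 2 * π * Complex.I * n * u = ((2 * π * n * u : ℝ) : ℂ) * Complex.I by
      push_cast; ring, Complex.norm_exp_ofReal_mul_I, mul_one]
  have hint (n : ℤ) : IntegrableOn (fun u : ℝ => unitFourierCoeff f n *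
      Complex.exp (2 * π * Complex.I * n * u) * (logTanUnit u : ℂ)) (Ioo 0 1) :=
    integrableOn_mul_logTanUnit (Continuous.aestronglyMeasurable (by fun_prop))
      fun u _ => (hnorm n u).le
  have h := hasSum_integral_of_summable_integral_norm hint (by
    simp only [norm_mul _ ((logTanUnit _ : ℝ) : ℂ), hnorm, integral_const_mul]
    exact hs.norm.mul_right _)
  have e : ∫ u in Ioo (0 : ℝ) 1, ∑' n : ℤ, unitFourierCoeff f n *
      Complex.exp (2 * π * Complex.I * n * u) * (logTanUnit u : ℂ) =
      ∫ u in Ioo (0 : ℝ) 1, f u * (logTanUnit u : ℂ) :=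
    setIntegral_congr_fun measurableSet_Ioo fun u hu =>
      ((hasSum_unitFourierCoeff hf h01 hs (Ioo_subset_Ico_self hu)).mul_right _).tsum_eq
  rw [e] at h
  -- This pairing counts frequency `0` twice; the extra term vanishes because `log tan` has mean
  -- zero.
  have h2 := h.nat_add_neg
  have e0 : ∫ u in Ioo (0 : ℝ) 1, unitFourierCoeff f 0 *
      Complex.exp (2 * π * Complex.I * (0 : ℤ) * u) * (logTanUnit u : ℂ) = 0 := by
    simp [integral_const_mul, integral_logTanUnit]
  rw [e0, add_zero] at h2
  refine h2.congr_fun fun n => ?_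
  have e1 := integral_exp_mul_logTanUnit n
  have e2 := integral_exp_neg_mul_logTanUnit n
  simp only [mul_assoc (unitFourierCoeff f _), integral_const_mul]
  have e3 (u : ℝ) : 2 * π * Complex.I * ((n : ℤ) : ℂ) * u = 2 * π * Complex.I * u * n := by
    push_cast; ring
  have e4 (u : ℝ) : 2 * π * Complex.I * ((-n : ℤ) : ℂ) * u = -(2 * π * Complex.I * u * n) := by
    push_cast; ring
  simp only [e3, e4, e1, e2]
  ring

/-- A continuous periodic modification of `u ↦ exp (-y u)`. -/
noncomputable def expRamp (y u : ℝ) : ℂ :=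
  Complex.exp (-(y * u)) + (1 - Complex.exp (-y)) * u

lemma unitFourierCoeff_expRamp (y : ℝ) {n : ℤ} (hn : n ≠ 0) :
    unitFourierCoeff (expRamp y) n = (1 - Complex.exp (-y)) *
      (1 / (2 * π * Complex.I * n + y) - 1 / (2 * π * Complex.I * n)) := by
  have hp : (π : ℂ) ≠ 0 := by exact_mod_cast Real.pi_ne_zero
  have hn' : (n : ℂ) ≠ 0 := by exact_mod_cast hn
  set θ : ℂ := 2 * π * Complex.I * n with hθ
  have hθ0 : θ ≠ 0 := by simp [hθ, hp, hn']
  have hθy : θ + y ≠ 0 := by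
    intro h
    have := congrArg Complex.im h
    simp [hθ, Real.pi_ne_zero, hn] at this
  have hθ1 : Complex.exp (-θ) = 1 := by
    rw [Complex.exp_eq_one_iff]
    exact ⟨-n, by rw [hθ]; push_cast; ring⟩
  have hlin (c : ℂ) (u : ℝ) : HasDerivAt (fun u : ℝ => Complex.exp (-(c * u)))
      (-c * Complex.exp (-(c * u))) u := by
    have := ((((hasDerivAt_id u).ofReal_comp).const_mul c).neg).cexp
    refine this.congr_deriv ?_
    simp; ring
  -- An explicit primitive: the first summand handles `e^{-(θ+y)u}`, and the rest is integration by
  -- parts for `u e^{-θu}`.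
  have hd : ∀ u ∈ uIcc (0 : ℝ) 1, HasDerivAt (fun u : ℝ =>
      -(Complex.exp (-((θ + y) * u)) / (θ + y)) + (1 - Complex.exp (-y)) *
        (-(u * Complex.exp (-(θ * u)) / θ) - Complex.exp (-(θ * u)) / θ ^ 2))
      (Complex.exp (-(θ * u)) * expRamp y u) u := by
    intro u _
    have hid : HasDerivAt (fun u : ℝ => (u : ℂ)) 1 u := by
      simpa using (hasDerivAt_id u).ofReal_comp
    have := (((hlin (θ + y) u).div_const (θ + y)).neg).add
      ((((((hid.mul (hlin θ u)).div_const θ).neg).sub ((hlin θ u).div_const (θ ^ 2)))).const_mul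
        (1 - Complex.exp (-(y : ℂ))))
    refine this.congr_deriv ?_
    rw [expRamp, show -((θ + y) * u) = -(θ * u) + -(y * u : ℂ) by ring, Complex.exp_add]
    field_simp
    ring
  have := intervalIntegral.integral_eq_sub_of_hasDerivAt hd (by
    apply Continuous.intervalIntegrable
    unfold expRamp
    fun_prop)
  rw [unitFourierCoeff, this]
  have e1 : Complex.exp (-((θ + y) * (1 : ℝ))) = Complex.exp (-y) := by
    rw [show -((θ + y) * ((1 : ℝ) : ℂ)) = -θ + -(y : ℂ) by push_cast; ring, Complex.exp_add, hθ1,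
      one_mul]
  rw [e1]
  simp only [Complex.ofReal_one, Complex.ofReal_zero, mul_one, mul_zero, neg_zero, Complex.exp_zero,
    hθ1]
  field_simp
  ring

/-- The linear ramp makes the values at `0` and `1` agree, so the coefficients decay like `y / n²`
instead of like `1/n`. -/
lemma summable_unitFourierCoeff_expRamp (y : ℝ) :
    Summable (unitFourierCoeff (expRamp y)) := by
  have h := (Real.summable_one_div_int_pow.2 (one_lt_two)).mul_left
    (‖1 - Complex.exp (-y)‖ * |y| / (4 * π ^ 2))
  refine Summable.of_norm_bounded_eventually h ?_
  have hev : ∀ᶠ n : ℤ in cofinite, n ≠ 0 := (Set.finite_singleton (0 : ℤ)).compl_mem_cofinite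
  filter_upwards [hev] with n hn
  have hp : (π : ℂ) ≠ 0 := by exact_mod_cast Real.pi_ne_zero
  have hpr := Real.pi_pos
  have hn' : (n : ℂ) ≠ 0 := by exact_mod_cast hn
  have hnr : (0 : ℝ) < |(n : ℝ)| := abs_pos.2 (by exact_mod_cast hn)
  set θ : ℂ := 2 * π * Complex.I * n with hθ
  have hθ0 : θ ≠ 0 := by simp [hθ, hp, hn']
  have hnθ : ‖θ‖ = 2 * π * |(n : ℝ)| := by
    simp [hθ, abs_of_pos hpr]
  have hnθy : 2 * π * |(n : ℝ)| ≤ ‖θ + y‖ := by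
    have := Complex.abs_im_le_norm (θ + y)
    refine le_trans (le_of_eq ?_) this
    simp [hθ, abs_mul, abs_of_pos hpr]
  have hpos : 0 < 2 * π * |(n : ℝ)| := by positivity
  have hθy : θ + y ≠ 0 := norm_pos_iff.1 (hpos.trans_le hnθy)
  rw [unitFourierCoeff_expRamp y hn, ← hθ,
    show 1 / (θ + y) - 1 / θ = -y / ((θ + y) * θ) by field_simp; ring, norm_mul, norm_div, norm_neg,
    norm_mul, hnθ, Complex.norm_real, Real.norm_eq_abs]
  calc _ ≤ ‖1 - Complex.exp (-y)‖ * (|y| / ((2 * π * |(n : ℝ)|) * (2 * π * |(n : ℝ)|))) := by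
        gcongr
    _ = _ := by
        rw [← sq_abs (n : ℝ)]
        field_simp
        norm_num

/-- This is the evaluated integral at `z = 0`: all interpolation defects vanish there, so `ζ(0, u) =
1/2 - u`, and the constant integrates to zero. -/
lemma integral_mul_logTanUnit_self :
    ∫ u in Ioo (0 : ℝ) 1, (u : ℂ) * (logTanUnit u : ℂ) = 2 / π ^ 2 * zetaH 2 := by
  have h := logTanMellin_eq (z := 0) (by simp)
  have hζ : ∀ u ∈ Ioo (0 : ℝ) 1, HurwitzZeta.hurwitzZeta (u : UnitAddCircle) 0 = 1 / 2 - u := by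
    intro u hu
    have := hurwitzZeta_sub_riemannZeta (z := 0) (by simp) hu
    simp only [cpowDefect, neg_zero, Complex.cpow_zero, riemannZeta_zero, mul_one, sub_sub,
      sub_add_cancel, sub_self, tsum_zero] at this
    linear_combination this
  have hi := integrableOn_self_mul_logTanUnit
  have e : logTanMellin 0 = ∫ u in Ioo (0 : ℝ) 1,
      ((1 / 2 : ℂ) * (logTanUnit u : ℂ) - (u : ℂ) * (logTanUnit u : ℂ)) := by
    rw [logTanMellin]
    refine setIntegral_congr_fun measurableSet_Ioo fun u hu => ?_
    simp only [hζ u hu]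
    ring
  have hc : IntegrableOn (fun u : ℝ => (1 / 2 : ℂ) * (logTanUnit u : ℂ)) (Ioo 0 1) :=
    Integrable.const_mul (integrableOn_logTanUnit.ofReal (𝕜 := ℂ)) _
  rw [integral_sub hc hi, integral_const_mul,
    integral_logTanUnit, mul_zero, zero_sub] at e
  have hp : (π : ℂ) ≠ 0 := by exact_mod_cast Real.pi_ne_zero
  rw [← neg_inj, ← e, h]
  simp only [zero_sub, sub_zero, Complex.cpow_neg_one, Complex.Gamma_one, mul_zero, zero_div,
    Complex.cos_zero]
  field_simp
  ring

lemma weightTerm_nonneg (y : ℝ) (n : ℕ) : 0 ≤ weightTerm y n :=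
  div_nonneg (oddHarmonic_nonneg n) (by positivity)

lemma weightTerm_le (y : ℝ) (n : ℕ) : weightTerm y n ≤ oddHarmonic n / (n : ℝ) ^ 2 := by
  rcases Nat.eq_zero_or_pos n with rfl | hn
  · simp [weightTerm, oddHarmonic_zero]
  · have : (0 : ℝ) < n := by exact_mod_cast hn
    exact div_le_div_of_nonneg_left (oddHarmonic_nonneg n) (by positivity)
      (le_add_of_nonneg_right (by positivity))

lemma summable_weightTerm (y : ℝ) : Summable (weightTerm y) :=
  Summable.of_nonneg_of_le (weightTerm_nonneg y) (weightTerm_le y) summable_oddHarmonic_div_sq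

lemma hasSum_weightTerm (y : ℝ) : HasSum (weightTerm y) (weightW y) := by
  have h := (summable_weightTerm y).hasSum
  rw [(summable_weightTerm y).tsum_eq_zero_add] at h
  simpa [weightTerm, oddHarmonic_zero, weightW] using h

lemma weightW_nonneg (y : ℝ) : 0 ≤ weightW y := tsum_nonneg fun _ => weightTerm_nonneg y _

lemma weightW_le (y : ℝ) : weightW y ≤ ∑' n : ℕ, oddHarmonic n / (n : ℝ) ^ 2 := by
  rw [← (hasSum_weightTerm y).tsum_eq]
  exact (summable_weightTerm y).tsum_le_tsum (weightTerm_le y) summable_oddHarmonic_div_sq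

lemma continuous_weightW : Continuous weightW := by
  have e : weightW = fun y => ∑' n, weightTerm y n :=
    funext fun y => (hasSum_weightTerm y).tsum_eq.symm
  rw [e]
  refine continuous_tsum (fun n => ?_) summable_oddHarmonic_div_sq fun n y => by
    rw [Real.norm_of_nonneg (weightTerm_nonneg y n)]; exact weightTerm_le y n
  rcases Nat.eq_zero_or_pos n with rfl | hn
  · simp [weightTerm, oddHarmonic_zero, continuous_const]
  · unfold weightTerm
    refine Continuous.div (by fun_prop) (by fun_prop) fun y => ?_
    positivity

/-- The Laplace transform of `log tan (π u / 2)` over the unit interval. -/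
lemma integral_exp_neg_mul_mul_logTanUnit (y : ℝ) :
    ∫ u in Ioo (0 : ℝ) 1, Complex.exp (-(y * u)) * (logTanUnit u : ℂ) =
      -(2 / π ^ 2) * ((1 - Complex.exp (-y)) * weightW y) := by
  have hp : (π : ℂ) ≠ 0 := by exact_mod_cast Real.pi_ne_zero
  have hcont : Continuous (expRamp y) := by unfold expRamp; fun_prop
  have h1 := hasSum_integral_mul_logTanUnit hcont
    (by simp [expRamp]) (summable_unitFourierCoeff_expRamp y)
  -- The `ζ_h(2)` here is cancelled at the end by the integral of the linear ramp, leaving only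
  -- `w(y)`.
  have h2 : HasSum (fun n : ℕ => (1 - Complex.exp (-y)) * (2 / π ^ 2) *
      ((oddHarmonic n : ℂ) / (n : ℂ) ^ 2 - (weightTerm y n : ℂ)))
      ((1 - Complex.exp (-y)) * (2 / π ^ 2) * (zetaH 2 - weightW y)) :=
    (hasSum_oddHarmonic_div_sq.sub (Complex.hasSum_ofReal.2 (hasSum_weightTerm y))).mul_left _
  have h3 := h1.unique (h2.congr_fun fun n => by
    rcases Nat.eq_zero_or_pos n with rfl | hn
    · simp [oddHarmonic_zero, weightTerm]
    have hnr : (0 : ℝ) < n := by exact_mod_cast hn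
    have hn' : (n : ℂ) ≠ 0 := by exact_mod_cast hn.ne'
    rw [unitFourierCoeff_expRamp y (by exact_mod_cast hn.ne'),
      unitFourierCoeff_expRamp y (by simpa using hn.ne'), weightTerm]
    have hd : ((n : ℂ) ^ 2 + ((y : ℂ) / (2 * π)) ^ 2) ≠ 0 := by
      have : (n : ℝ) ^ 2 + (y / (2 * π)) ^ 2 ≠ 0 := by positivity
      exact_mod_cast this
    have hd' : (y : ℂ) ^ 2 + (2 * π * n) ^ 2 ≠ 0 := by
      have : y ^ 2 + (2 * π * n) ^ 2 ≠ 0 := by positivity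
      exact_mod_cast this
    have hfac : (2 * π * Complex.I * n + y) * (-(2 * π * Complex.I * n) + y) =
        (y : ℂ) ^ 2 + (2 * π * n) ^ 2 := by
      linear_combination (-(2 * π * n : ℂ) ^ 2) * Complex.I_sq
    have hne1 : (2 * π * Complex.I * n + y : ℂ) ≠ 0 := fun h => hd' (by rw [← hfac, h, zero_mul])
    have hne2 : (-(2 * π * Complex.I * n) + y : ℂ) ≠ 0 :=
      fun h => hd' (by rw [← hfac, h, mul_zero])
    have k1 : 1 / (2 * π * Complex.I * n + y : ℂ) - 1 / (-(2 * π * Complex.I * n) + y) =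
        -(4 * π * Complex.I * n) / ((y : ℂ) ^ 2 + (2 * π * n) ^ 2) := by
      rw [← hfac]; field_simp; ring
    have k2 : (n : ℂ) ^ 2 + ((y : ℂ) / (2 * π)) ^ 2 =
      ((y : ℂ) ^ 2 + (2 * π * n) ^ 2) / (2 * π) ^ 2 := by field_simp; ring
    push_cast
    rw [k2]
    have k3 : (1 - Complex.exp (-y)) * (1 / (2 * π * Complex.I * n + y) -
        1 / (2 * π * Complex.I * n)) - (1 - Complex.exp (-y)) *
        (1 / (2 * π * Complex.I * -n + y) - 1 / (2 * π * Complex.I * -n)) =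
        (1 - Complex.exp (-y)) * (-(4 * π * Complex.I * n) / ((y : ℂ) ^ 2 + (2 * π * n) ^ 2) +
          Complex.I / (π * n)) := by
      rw [← k1, show (2 * π * Complex.I * -n : ℂ) = -(2 * π * Complex.I * n) by ring]
      have : Complex.I / (π * n) = - (2 / (2 * π * Complex.I * n)) := by
        field_simp
        rw [Complex.I_sq]
      rw [this]
      field_simp
      ring
    rw [k3]
    field_simp
    rw [Complex.I_sq]
    ring)
  have hiE : IntegrableOn (fun u : ℝ => Complex.exp (-(y * u)) * (logTanUnit u : ℂ)) (Ioo 0 1) :=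
    integrableOn_mul_logTanUnit (C := Real.exp |y|) (Continuous.aestronglyMeasurable (by fun_prop))
      fun u hu => by
        rw [show (-(y * u : ℂ)) = ((-(y * u) : ℝ) : ℂ) by push_cast; rfl, Complex.norm_exp_ofReal,
          Real.exp_le_exp]
        nlinarith [neg_abs_le y, abs_nonneg y, hu.1, hu.2]
  have hi := integrableOn_self_mul_logTanUnit
  simp only [expRamp, add_mul, mul_assoc (1 - Complex.exp (-(y : ℂ))) _ ((logTanUnit _ : ℝ) : ℂ)]
    at h3
  rw [integral_add hiE (Integrable.const_mul hi _), integral_const_mul,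
    integral_mul_logTanUnit_self] at h3
  linear_combination h3

lemma integrableOn_weightIntegrand {z : ℂ} (hz : 0 < z.re) :
    IntegrableOn (weightIntegrand z) (Ioi 0) := by
  have h := (Complex.GammaIntegral_convergent hz).bdd_mul (f := fun y => (weightW y : ℂ))
    (c := ∑' n : ℕ, oddHarmonic n / (n : ℝ) ^ 2)
    (Complex.continuous_ofReal.comp continuous_weightW).aestronglyMeasurable
    (Eventually.of_forall fun y => by
      rw [Complex.norm_of_nonneg (weightW_nonneg y)]; exact weightW_le y)
  refine h.congr (Eventually.of_forall fun y => ?_)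
  simp only [weightIntegrand, mul_assoc]

/-! ### The contribution of `ζ(z, u) - u^{-z}`. -/

/-- The moments of `log tan (π u / 2)` against shifted powers. -/
noncomputable def shiftedCpowIntegral (z : ℂ) (n : ℕ) : ℂ :=
  ∫ u in Ioo (0 : ℝ) 1, ((n + 1 + u : ℝ) : ℂ) ^ (-z) * (logTanUnit u : ℂ)

lemma integrableOn_cpow_mul_exp_neg {z : ℂ} (hz : 0 < z.re) (n : ℕ) :
    IntegrableOn (fun y : ℝ => (y : ℂ) ^ (z - 1) * Complex.exp (-((n + 1) * y))) (Ioi 0) := by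
  have h := (Complex.GammaIntegral_convergent hz).bdd_mul
    (f := fun y : ℝ => Complex.exp (-(n * y))) (c := 1)
    (Continuous.aestronglyMeasurable (by fun_prop)) (by
      filter_upwards [ae_restrict_mem measurableSet_Ioi] with y hy
      have hy : 0 < y := hy
      rw [show (-(n * y : ℂ)) = ((-(n * y) : ℝ) : ℂ) by push_cast; rfl, Complex.norm_exp_ofReal,
        Real.exp_le_one_iff]
      have : 0 ≤ (n : ℝ) * y := by positivity
      linarith)
  refine h.congr (Eventually.of_forall fun y => ?_)
  simp only
  rw [show (-((n + 1) * y : ℂ)) = -(n * y) + -y by ring, Complex.exp_add]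
  push_cast
  ring

/-- Write `Γ(z) (n + 1 + u)^{-z}` as an integral of `y^{z-1} e^{-(n+1+u)y}` and exchange the
integrals; the inner one is the Laplace transform of `log tan`. -/
lemma Gamma_mul_shiftedCpowIntegral {z : ℂ} (hz : 0 < z.re) (n : ℕ) :
    Complex.Gamma z * shiftedCpowIntegral z n = ∫ y in Ioi (0 : ℝ),
      (y : ℂ) ^ (z - 1) * Complex.exp (-((n + 1) * y)) *
        (-(2 / π ^ 2) * ((1 - Complex.exp (-y)) * weightW y)) := by
  set F : ℝ → ℝ → ℂ := fun u y => (logTanUnit u : ℂ) *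
    ((y : ℂ) ^ (z - 1) * Complex.exp (-((n + 1) * y))) * Complex.exp (-(y * u)) with hF
  have hint : Integrable (Function.uncurry F)
      ((volume.restrict (Ioo (0 : ℝ) 1)).prod (volume.restrict (Ioi (0 : ℝ)))) := by
    have h1 := Integrable.mul_prod (integrableOn_logTanUnit.ofReal (𝕜 := ℂ))
      (integrableOn_cpow_mul_exp_neg hz n)
    refine h1.mul_bdd (c := 1) (g := fun p : ℝ × ℝ => Complex.exp (-(p.2 * p.1)))
      (Continuous.aestronglyMeasurable (by fun_prop)) ?_
    rw [Measure.prod_restrict]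
    filter_upwards [ae_restrict_mem (measurableSet_Ioo.prod measurableSet_Ioi)] with p hp
    have h0 : 0 < p.1 := hp.1.1
    have h2 : 0 < p.2 := hp.2
    rw [show (-(p.2 * p.1 : ℂ)) = ((-(p.2 * p.1) : ℝ) : ℂ) by push_cast; rfl,
      Complex.norm_exp_ofReal, Real.exp_le_one_iff]
    have : 0 < p.2 * p.1 := by positivity
    linarith
  have hswap := integral_integral_swap hint
  have e1 : ∀ u ∈ Ioo (0 : ℝ) 1, ∫ y in Ioi (0 : ℝ), F u y =
      Complex.Gamma z * (((n + 1 + u : ℝ) : ℂ) ^ (-z) * (logTanUnit u : ℂ)) := by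
    intro u hu
    have hpos : (0 : ℝ) < n + 1 + u := by linarith [hu.1, (n.cast_nonneg : (0 : ℝ) ≤ n)]
    have hG := Complex.integral_cpow_mul_exp_neg_mul_Ioi hz hpos
    have hinv : (1 / ((n + 1 + u : ℝ) : ℂ)) ^ z = ((n + 1 + u : ℝ) : ℂ) ^ (-z) := by
      rw [one_div, Complex.inv_cpow _ _ (by
        rw [Complex.arg_ofReal_of_nonneg hpos.le]; exact Real.pi_ne_zero.symm), Complex.cpow_neg]
    rw [hinv] at hG
    have e (y : ℝ) : F u y = (logTanUnit u : ℂ) * ((y : ℂ) ^ (z - 1) *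
        Complex.exp (-(((n + 1 + u : ℝ) : ℂ) * y))) := by
      simp only [hF]
      rw [mul_assoc, mul_assoc, ← Complex.exp_add]
      congr 3
      push_cast; ring
    simp only [e]
    rw [integral_const_mul, hG]
    ring
  rw [shiftedCpowIntegral, ← integral_const_mul, ← setIntegral_congr_fun measurableSet_Ioo e1, hswap]
  refine setIntegral_congr_fun measurableSet_Ioi fun y _ => ?_
  have e (u : ℝ) : F u y = (y : ℂ) ^ (z - 1) * Complex.exp (-((n + 1) * y)) *
      (Complex.exp (-(y * u)) * (logTanUnit u : ℂ)) := by
    simp only [hF]; ring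
  simp only [e]
  rw [integral_const_mul, integral_exp_neg_mul_mul_logTanUnit]

/-- The geometric sum `∑ e^{-(n+1)y} (1 - e^{-y}) = e^{-y}` turns the integrands into the weight
integrand. As every factor but the power of `y` is real and nonnegative, apart from sign, the norms
sum the same way and provide the dominating function. -/
lemma hasSum_Gamma_mul_shiftedCpowIntegral {z : ℂ} (hz : 0 < z.re) :
    HasSum (fun n => Complex.Gamma z * shiftedCpowIntegral z n)
      (-(2 / π ^ 2) * ∫ y in Ioi (0 : ℝ), weightIntegrand z y) := by
  simp only [Gamma_mul_shiftedCpowIntegral hz]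
  rw [← integral_const_mul]
  have hgeom : ∀ y ∈ Ioi (0 : ℝ), HasSum (fun n : ℕ => Real.exp (-((n + 1) * y)) *
      (1 - Real.exp (-y))) (Real.exp (-y)) := by
    intro y hy
    have hy : 0 < y := hy
    have hlt : Real.exp (-y) < 1 := by simpa using hy
    have h := ((hasSum_geometric_of_lt_one (Real.exp_pos _).le hlt).mul_left
      (Real.exp (-y))).mul_right (1 - Real.exp (-y))
    rw [mul_assoc, inv_mul_cancel₀ (by linarith), mul_one] at h
    refine h.congr_fun fun n => ?_
    rw [← Real.exp_nat_mul, ← Real.exp_add]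
    congr 2
    ring
  refine hasSum_integral_of_dominated_convergence
    (fun n y => (Real.exp (-((n + 1) * y)) * (1 - Real.exp (-y))) *
      (y ^ (z.re - 1) * (2 / π ^ 2 * weightW y))) (fun n => ?_) (fun n => ?_) ?_ ?_ ?_
  · refine AEStronglyMeasurable.mul (integrableOn_cpow_mul_exp_neg hz n).1 ?_
    have := Complex.continuous_ofReal.comp continuous_weightW
    refine Continuous.aestronglyMeasurable ?_
    fun_prop
  · filter_upwards [ae_restrict_mem measurableSet_Ioi] with y hy
    have hy : 0 < y := hy
    have hlt : Real.exp (-y) < 1 := by simpa using hy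
    have e1 : (1 - Complex.exp (-y)) = ((1 - Real.exp (-y) : ℝ) : ℂ) := by push_cast; rfl
    have e2 : Complex.exp (-((n + 1) * y)) = ((Real.exp (-((n + 1) * y)) : ℝ) : ℂ) := by
      push_cast; rfl
    have e3 : (-(2 / π ^ 2) : ℂ) = ((-(2 / π ^ 2) : ℝ) : ℂ) := by push_cast; rfl
    rw [e1, e2, e3]
    simp only [norm_mul, Complex.norm_cpow_eq_rpow_re_of_pos hy, Complex.norm_real]
    rw [Real.norm_of_nonneg (Real.exp_pos _).le, norm_neg,
      Real.norm_of_nonneg (by linarith : (0 : ℝ) ≤ 1 - Real.exp (-y)),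
      Real.norm_of_nonneg (weightW_nonneg y), Real.norm_of_nonneg (by positivity)]
    apply le_of_eq
    simp only [Complex.sub_re, Complex.one_re]
    ring
  · filter_upwards [ae_restrict_mem measurableSet_Ioi] with y hy
    exact ((hgeom y hy).mul_right _).summable
  · refine ((integrableOn_weightIntegrand hz).norm.const_mul (2 / π ^ 2)).congr ?_
    filter_upwards [ae_restrict_mem measurableSet_Ioi] with y hy
    rw [((hgeom y hy).mul_right _).tsum_eq, weightIntegrand]
    have hy : 0 < y := hy
    simp only [norm_mul, Complex.norm_cpow_eq_rpow_re_of_pos hy, Complex.norm_real]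
    rw [Real.norm_of_nonneg (Real.exp_pos _).le, Real.norm_of_nonneg (weightW_nonneg y)]
    simp only [Complex.sub_re, Complex.one_re]
    ring
  · filter_upwards [ae_restrict_mem measurableSet_Ioi] with y hy
    have h := (Complex.hasSum_ofReal.2 (hgeom y hy)).mul_left
      (-(2 / π ^ 2) * (weightW y * (y : ℂ) ^ (z - 1)))
    have e : -(2 / π ^ 2 : ℂ) * weightIntegrand z y =
        -(2 / π ^ 2) * (weightW y * (y : ℂ) ^ (z - 1)) * (Real.exp (-y) : ℝ) := by
      rw [weightIntegrand]; ring
    rw [e]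
    refine h.congr_fun fun n => ?_
    push_cast
    ring

lemma integrableOn_cpow_neg_mul_logTanUnit {z : ℂ} (hz : z.re < 1) :
    IntegrableOn (fun u : ℝ => (u : ℂ) ^ (-z) * (logTanUnit u : ℂ)) (Ioo 0 1) := by
  refine (integrableOn_rpow_mul_logTanUnit hz).mono' ?_ ?_
  · exact Measurable.aestronglyMeasurable (by fun_prop)
  · filter_upwards [ae_restrict_mem measurableSet_Ioo] with u hu
    rw [norm_mul, Complex.norm_cpow_eq_rpow_re_of_pos hu.1, Complex.norm_real, Real.norm_eq_abs,
      Complex.neg_re]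

lemma integrableOn_cpowDefect_mul_logTanUnit {z : ℂ} (hz : -1 < z.re) (n : ℕ) :
    IntegrableOn (fun u : ℝ => cpowDefect z u n * (logTanUnit u : ℂ)) (Ioo 0 1) := by
  refine integrableOn_mul_logTanUnit (C := 2 * (‖z‖ * ‖z + 1‖ * ((n : ℝ) + 1) ^ (-z.re - 2))) ?_
    fun u hu => norm_cpowDefect_le hz (Ioo_subset_Icc_self hu) n
  unfold cpowDefect
  exact Measurable.aestronglyMeasurable (by fun_prop)

lemma hasSum_integral_cpowDefect_mul_logTanUnit {z : ℂ} (hz : -1 < z.re) :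
    HasSum (fun n => ∫ u in Ioo (0 : ℝ) 1, cpowDefect z u n * (logTanUnit u : ℂ))
      (∫ u in Ioo (0 : ℝ) 1, (∑' n, cpowDefect z u n) * (logTanUnit u : ℂ)) := by
  have h := hasSum_integral_of_summable_integral_norm
    (integrableOn_cpowDefect_mul_logTanUnit hz) ?_
  · simpa only [tsum_mul_right] using h
  · have hb := summable_add_one_rpow (ρ := z.re + 1) (by linarith) (‖z‖ * (‖z‖ + 1))
    refine Summable.of_nonneg_of_le (fun n => integral_nonneg fun u => norm_nonneg _) (fun n => ?_)
      (hb.mul_right (∫ u in Ioo (0 : ℝ) 1, |logTanUnit u|))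
    rw [← integral_const_mul]
    refine setIntegral_mono_on (integrableOn_cpowDefect_mul_logTanUnit hz n).norm
      (integrableOn_logTanUnit.abs.const_mul _) measurableSet_Ioo fun u hu => ?_
    rw [norm_mul, Complex.norm_real, Real.norm_eq_abs]
    gcongr
    exact norm_cpowDefect_le_of_bounds (by linarith) (by linarith) le_rfl
      (Ioo_subset_Icc_self hu) n

/-- The constant part of the interpolant integrates to zero, and its slope leaves a difference that
telescopes in `n`. -/
lemma integral_cpowDefect_mul_logTanUnit {z : ℂ} (hz : 0 < z.re) (n : ℕ) :
    ∫ u in Ioo (0 : ℝ) 1, cpowDefect z u n * (logTanUnit u : ℂ) =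
      shiftedCpowIntegral z n + (∫ u in Ioo (0 : ℝ) 1, (u : ℂ) * (logTanUnit u : ℂ)) *
        (((n + 1 : ℝ) : ℂ) ^ (-z) - ((n + 2 : ℝ) : ℂ) ^ (-z)) := by
  have hI : IntegrableOn (fun u : ℝ => ((n + 1 + u : ℝ) : ℂ) ^ (-z) * (logTanUnit u : ℂ))
      (Ioo 0 1) := by
    refine integrableOn_mul_logTanUnit (C := 1) (Measurable.aestronglyMeasurable (by fun_prop))
      fun u hu => ?_
    have h1 : (1 : ℝ) ≤ n + 1 + u := by linarith [hu.1, (n.cast_nonneg : (0 : ℝ) ≤ n)]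
    rw [Complex.norm_cpow_eq_rpow_re_of_pos (by linarith)]
    exact Real.rpow_le_one_of_one_le_of_nonpos h1 (by simpa using hz.le)
  have hu := integrableOn_self_mul_logTanUnit
  have hc := integrableOn_logTanUnit.ofReal (𝕜 := ℂ)
  have e (u : ℝ) : cpowDefect z u n * (logTanUnit u : ℂ) =
      ((n + 1 + u : ℝ) : ℂ) ^ (-z) * (logTanUnit u : ℂ) +
      ((((n + 1 : ℝ) : ℂ) ^ (-z) - ((n + 2 : ℝ) : ℂ) ^ (-z)) * ((u : ℂ) * (logTanUnit u : ℂ)) +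
      (-(((n + 1 : ℝ) : ℂ) ^ (-z))) * (logTanUnit u : ℂ)) := by
    rw [cpowDefect]; ring
  simp only [e]
  have hc' : IntegrableOn (fun u : ℝ => (-(((n + 1 : ℝ) : ℂ) ^ (-z))) * (logTanUnit u : ℂ))
    (Ioo 0 1) := Integrable.const_mul hc _
  have hu' : IntegrableOn (fun u : ℝ => (((n + 1 : ℝ) : ℂ) ^ (-z) - ((n + 2 : ℝ) : ℂ) ^ (-z)) *
    ((u : ℂ) * (logTanUnit u : ℂ))) (Ioo 0 1) := Integrable.const_mul hu _
  rw [integral_add hI (by exact Integrable.add hu' hc'), integral_add hu' hc',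
    integral_const_mul, integral_const_mul, integral_logTanUnit, shiftedCpowIntegral]
  ring

/-- For `Re z > 0` the telescoping differences sum to `1`, so they contribute exactly the integral
of `u log tan`, which cancels the `-u` in the defect formula. The constant `ζ(z)` integrates to
zero, and only the shifted powers survive. -/
lemma integral_hurwitzZeta_sub_cpow_mul_logTanUnit {z : ℂ} (hz : 0 < z.re) (hz1 : z.re < 1) :
    ∫ u in Ioo (0 : ℝ) 1, (HurwitzZeta.hurwitzZeta (u : UnitAddCircle) z - (u : ℂ) ^ (-z)) *
      (logTanUnit u : ℂ) =
    -(2 / π ^ 2) * (1 / Complex.Gamma z) * ∫ y in Ioi (0 : ℝ), weightIntegrand z y := by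
  have hΓ := Complex.Gamma_ne_zero_of_re_pos hz
  set A := ∫ u in Ioo (0 : ℝ) 1, (u : ℂ) * (logTanUnit u : ℂ) with hA
  have hI : HasSum (shiftedCpowIntegral z)
      (-(2 / π ^ 2) * (1 / Complex.Gamma z) * ∫ y in Ioi (0 : ℝ), weightIntegrand z y) := by
    have := (hasSum_Gamma_mul_shiftedCpowIntegral hz).mul_left (1 / Complex.Gamma z)
    simp only [← mul_assoc, one_div_mul_cancel hΓ, one_mul] at this
    rwa [mul_comm (1 / Complex.Gamma z)] at this
  have hD := hasSum_integral_cpowDefect_mul_logTanUnit (z := z) (by linarith)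
  have htel : Tendsto (fun N : ℕ => ∑ n ∈ Finset.range N,
      (((n + 1 : ℝ) : ℂ) ^ (-z) - ((n + 2 : ℝ) : ℂ) ^ (-z))) atTop (𝓝 1) := by
    have e (N : ℕ) : ∑ n ∈ Finset.range N,
        (((n + 1 : ℝ) : ℂ) ^ (-z) - ((n + 2 : ℝ) : ℂ) ^ (-z)) = 1 - ((N + 1 : ℝ) : ℂ) ^ (-z) := by
      induction N with
      | zero => simp
      | succ N ih =>
        rw [Finset.sum_range_succ, ih]
        push_cast
        rw [show (N : ℂ) + 1 + 1 = N + 2 by ring]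
        ring
    simp only [e]
    have h0 : Tendsto (fun N : ℕ => ((N + 1 : ℝ) : ℂ) ^ (-z)) atTop (𝓝 0) := by
      rw [tendsto_zero_iff_norm_tendsto_zero]
      have h1 := (tendsto_rpow_neg_atTop hz).comp
        (tendsto_atTop_add_const_right _ 1 tendsto_natCast_atTop_atTop)
      refine h1.congr fun N => ?_
      rw [Complex.norm_cpow_eq_rpow_re_of_pos (by positivity)]
      simp
    simpa using h0.const_sub 1
  have hlim := hI.tendsto_sum_nat.add (htel.const_mul A)
  have hS := tendsto_nhds_unique (hD.tendsto_sum_nat) (hlim.congr fun N => by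
    rw [Finset.mul_sum, ← Finset.sum_add_distrib]
    exact Finset.sum_congr rfl fun n _ => (integral_cpowDefect_mul_logTanUnit hz n).symm)
  have hTint : IntegrableOn (fun u : ℝ => (∑' n, cpowDefect z u n) * (logTanUnit u : ℂ))
      (Ioo 0 1) :=
    integrableOn_mul_logTanUnit (((continuousOn_tsum_cpowDefect (by linarith)).mono
      Ioo_subset_Icc_self).aestronglyMeasurable measurableSet_Ioo) fun u hu =>
      tsum_of_norm_bounded (summable_add_one_rpow (ρ := z.re + 1) (by linarith) _).hasSum
        (norm_cpowDefect_le_of_bounds (by linarith) (by linarith) le_rfl (Ioo_subset_Icc_self hu))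
  have e : ∫ u in Ioo (0 : ℝ) 1, (HurwitzZeta.hurwitzZeta (u : UnitAddCircle) z -
      (u : ℂ) ^ (-z)) * (logTanUnit u : ℂ) = ∫ u in Ioo (0 : ℝ) 1,
      ((∑' n, cpowDefect z u n) * (logTanUnit u : ℂ) +
        (riemannZeta z * (logTanUnit u : ℂ) - (u : ℂ) * (logTanUnit u : ℂ))) := by
    refine setIntegral_congr_fun measurableSet_Ioo fun u hu => ?_
    have := hurwitzZeta_sub_riemannZeta (z := z) (by linarith) hu
    linear_combination (logTanUnit u : ℂ) * this
  have hc' : IntegrableOn (fun u : ℝ => riemannZeta z * (logTanUnit u : ℂ))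
    (Ioo 0 1) := Integrable.const_mul (integrableOn_logTanUnit.ofReal (𝕜 := ℂ)) _
  rw [e, integral_add hTint (by exact Integrable.sub hc' integrableOn_self_mul_logTanUnit),
    integral_sub hc' integrableOn_self_mul_logTanUnit, integral_const_mul, integral_logTanUnit, hS]
  ring

/-! ### Power series of `log tan` and the contribution of `u^{-z}`. -/

/-- The value `ζ(2k + 2)` as a real number. -/
noncomputable def realZetaEven (k : ℕ) : ℝ := ∑' j : ℕ, (1 / ((j : ℝ) + 1) ^ 2) ^ (k + 1)

lemma summable_realZetaEven (k : ℕ) :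
    Summable fun j : ℕ => (1 / ((j : ℝ) + 1) ^ 2) ^ (k + 1) := by
  have h := (summable_nat_add_iff 1).2
    (Real.summable_one_div_nat_pow.2 (show 1 < 2 * (k + 1) by omega))
  refine h.congr fun j => ?_
  rw [div_pow, one_pow, ← pow_mul]
  push_cast
  rfl

lemma ofReal_realZetaEven (k : ℕ) : (realZetaEven k : ℂ) = riemannZeta (2 * (k + 1 : ℕ)) := by
  have h : 1 < (2 * ((k + 1 : ℕ) : ℂ)).re := by
    have : (0 : ℝ) ≤ k := k.cast_nonneg
    simp; linarith
  rw [zeta_eq_tsum_one_div_nat_add_one_cpow h, realZetaEven, Complex.ofReal_tsum]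
  refine tsum_congr fun j => ?_
  rw [show (2 * ((k + 1 : ℕ) : ℂ)) = ((2 * (k + 1) : ℕ) : ℂ) by push_cast; ring,
    Complex.cpow_natCast, pow_mul]
  push_cast
  rw [div_pow, one_pow]

lemma realZetaEven_pos (k : ℕ) : 0 < realZetaEven k :=
  (summable_realZetaEven k).tsum_pos (fun j => by positivity) 0 (by positivity)

lemma realZetaEven_le (k : ℕ) : realZetaEven k ≤ realZetaEven 0 := by
  refine (summable_realZetaEven k).tsum_le_tsum (fun j => ?_) (summable_realZetaEven 0)
  refine pow_le_pow_of_le_one (by positivity) ?_ (by omega)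
  rw [div_le_one (by positivity)]
  nlinarith [(j.cast_nonneg : (0 : ℝ) ≤ j)]

/-- The logarithm of Euler's sine product; the terms are nonnegative, so convergence of the partial
products is enough. -/
lemma hasSum_neg_log_euler_sine {v : ℝ} (hv : v ∈ Ioo (0 : ℝ) 1) :
    HasSum (fun j : ℕ => -Real.log (1 - v ^ 2 / ((j : ℝ) + 1) ^ 2))
      (-Real.log (Real.sin (π * v) / (π * v))) := by
  have hp := Real.pi_pos
  have hv0 := hv.1
  have hsin : 0 < Real.sin (π * v) :=
    Real.sin_pos_of_pos_of_lt_pi (by positivity) (by nlinarith [hv.2])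
  have hlt (j : ℕ) : v ^ 2 / ((j : ℝ) + 1) ^ 2 < 1 := by
    rw [div_lt_one (by positivity)]
    have : (1 : ℝ) ≤ ((j : ℝ) + 1) ^ 2 := by nlinarith [(j.cast_nonneg : (0 : ℝ) ≤ j)]
    nlinarith [hv.2]
  have hnn (j : ℕ) : 0 ≤ v ^ 2 / ((j : ℝ) + 1) ^ 2 := by positivity
  rw [hasSum_iff_tendsto_nat_of_nonneg fun j => by
    have := Real.log_nonpos (by linarith [hlt j]) (by linarith [hnn j] :
      1 - v ^ 2 / ((j : ℝ) + 1) ^ 2 ≤ 1)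
    linarith]
  have h := (Real.tendsto_euler_sin_prod v).div_const (π * v)
  have h2 := ((Real.continuousAt_log (div_pos hsin (by positivity)).ne').tendsto.comp h).neg
  refine h2.congr fun n => ?_
  simp only [Function.comp]
  rw [mul_div_cancel_left₀ _ (by positivity), Real.log_prod fun j _ => by
    linarith [hlt j], Finset.sum_neg_distrib]

/-- The power series of `log (sin (π v) / (π v))`. -/
lemma hasSum_realZetaEven_mul_pow {v : ℝ} (hv : v ∈ Ioo (0 : ℝ) 1) :
    HasSum (fun k : ℕ => realZetaEven k / (k + 1) * v ^ (2 * (k + 1)))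
      (-Real.log (Real.sin (π * v) / (π * v))) := by
  have hv0 := hv.1
  -- A nonnegative double series: summing over the second index first gives the logarithms in
  -- Euler's product, summing over the first index first gives the zeta values.
  set f : ℕ × ℕ → ℝ := fun p => (v ^ 2 / ((p.1 : ℝ) + 1) ^ 2) ^ (p.2 + 1) / (p.2 + 1) with hf
  have hrow (j : ℕ) : HasSum (fun k => f (j, k)) (-Real.log (1 - v ^ 2 / ((j : ℝ) + 1) ^ 2)) := by
    have hlt : |v ^ 2 / ((j : ℝ) + 1) ^ 2| < 1 := by
      rw [abs_of_nonneg (by positivity), div_lt_one (by positivity)]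
      have : (1 : ℝ) ≤ ((j : ℝ) + 1) ^ 2 := by nlinarith [(j.cast_nonneg : (0 : ℝ) ≤ j)]
      nlinarith [hv.2]
    simpa only [hf] using hasSum_pow_div_log_of_abs_lt_one hlt
  have hcol (k : ℕ) : HasSum (fun j => f (j, k)) (realZetaEven k / (k + 1) * v ^ (2 * (k + 1))) := by
    have h := (summable_realZetaEven k).hasSum.mul_right (v ^ (2 * (k + 1)) / (k + 1))
    rw [← realZetaEven] at h
    convert! h using 1
    · funext j
      simp only [hf]
      rw [pow_mul v, div_eq_mul_one_div (v ^ 2), mul_pow]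
      ring
    · ring
  have hlog := hasSum_neg_log_euler_sine hv
  have hsum : Summable f := (summable_prod_of_nonneg fun p => by positivity).2
    ⟨fun j => (hrow j).summable, hlog.summable.congr fun j => (hrow j).tsum_eq.symm⟩
  have h1 := hsum.hasSum.prod_fiberwise hrow
  have h2 := ((Equiv.prodComm ℕ ℕ).hasSum_iff.2 hsum.hasSum).prod_fiberwise hcol
  rwa [h1.unique hlog] at h2

/-- The coefficients of `log (tan x / x)` in powers of `(2x/π)²`. -/
noncomputable def logTanCoeff (k : ℕ) : ℝ :=
  (1 - 1 / 2 ^ (2 * k + 1)) * (realZetaEven k / (k + 1))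

lemma one_div_two_pow_le_half (k : ℕ) : (1 : ℝ) / 2 ^ (2 * k + 1) ≤ 1 / 2 := by
  gcongr
  exact le_self_pow₀ one_le_two (by omega)

lemma logTanCoeff_pos (k : ℕ) : 0 < logTanCoeff k := by
  have h1 := one_div_two_pow_le_half k
  have h2 := realZetaEven_pos k
  exact mul_pos (by linarith) (by positivity)

lemma logTanCoeff_le (k : ℕ) : logTanCoeff k ≤ realZetaEven 0 / (k + 1) := by
  have h1 : (0 : ℝ) < 1 / 2 ^ (2 * k + 1) := by positivity
  have h2 := realZetaEven_pos k
  have h3 := realZetaEven_le k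
  calc logTanCoeff k ≤ 1 * (realZetaEven k / (k + 1)) := by
        unfold logTanCoeff; gcongr; linarith
    _ ≤ _ := by rw [one_mul]; gcongr

/-- Since `tan x = 2 sin² x / sin 2x`, the sine series at `u` minus twice the one at `u/2` gives the
result; the factor `1 - 2^{-(2k+1)}` comes from this combination. -/
lemma hasSum_logTanUnit {u : ℝ} (hu : u ∈ Ioo (0 : ℝ) 1) :
    HasSum (fun k : ℕ => logTanCoeff k * u ^ (2 * (k + 1)))
      (logTanUnit u - Real.log u - Real.log (π / 2)) := by
  have hp := Real.pi_pos
  have hu0 := hu.1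
  have h1 := hasSum_realZetaEven_mul_pow hu
  have h2 := hasSum_realZetaEven_mul_pow (v := u / 2) ⟨by linarith, by linarith [hu.2]⟩
  have hs : 0 < Real.sin (π * u / 2) :=
    Real.sin_pos_of_pos_of_lt_pi (by positivity) (by nlinarith [hu.2])
  have hc : 0 < Real.cos (π * u / 2) :=
    Real.cos_pos_of_mem_Ioo ⟨by nlinarith [hu.1], by nlinarith [hu.2]⟩
  have e : Real.sin (π * u) = 2 * Real.sin (π * u / 2) * Real.cos (π * u / 2) := by
    rw [← Real.sin_two_mul]; ring_nf
  have h := h1.sub (h2.mul_left 2)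
  convert! h using 1
  · funext k
    have h4 : (u / 2) ^ (2 * (k + 1)) = u ^ (2 * (k + 1)) / 2 ^ (2 * k + 1) / 2 := by
      rw [div_pow, div_div, ← pow_succ, show 2 * (k + 1) = 2 * k + 1 + 1 by ring]
    rw [logTanCoeff, h4]
    ring
  · have e1 : Real.log (Real.sin (π * u) / (π * u)) = Real.log 2 + Real.log (Real.sin (π * u / 2)) +
        Real.log (Real.cos (π * u / 2)) - (Real.log π + Real.log u) := by
      rw [e, Real.log_div (by positivity) (by positivity), Real.log_mul (by positivity) hc.ne',
        Real.log_mul two_ne_zero hs.ne', Real.log_mul hp.ne' hu0.ne']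
    have e2 : Real.log (Real.sin (π * (u / 2)) / (π * (u / 2))) =
        Real.log (Real.sin (π * u / 2)) - (Real.log π + Real.log u - Real.log 2) := by
      rw [← mul_div_assoc, Real.log_div hs.ne' (by positivity), Real.log_div (by positivity)
        two_ne_zero, Real.log_mul hp.ne' hu0.ne']
    rw [e1, e2, logTanUnit, Real.tan_eq_sin_div_cos, Real.log_div hs.ne' hc.ne',
      Real.log_div hp.ne' two_ne_zero]
    ring

lemma contTerm_succ (z : ℂ) (k : ℕ) :
    contTerm z (k + 1) = (logTanCoeff k : ℂ) / (2 * k + 3 - z) := by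
  rw [contTerm, ← ofReal_realZetaEven, logTanCoeff, show 2 * (k + 1) - 1 = 2 * k + 1 by omega,
    show (2 * ((k + 1 : ℕ) : ℂ) + 1 - z) = 2 * k + 3 - z by push_cast; ring]
  push_cast
  rw [← div_div, mul_div_assoc]

lemma integral_cpow_sub_one_unit {s : ℂ} (hs : 0 < s.re) :
    IntegrableOn (fun u : ℝ => (u : ℂ) ^ (s - 1)) (Ioo 0 1) ∧
      ∫ u in Ioo (0 : ℝ) 1, (u : ℂ) ^ (s - 1) = 1 / s := by
  have hne : s ≠ 0 := fun h => by simp [h] at hs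
  constructor
  · have := intervalIntegral.intervalIntegrable_cpow' (a := 0) (b := 1) (r := s - 1) (by simpa)
    rwa [intervalIntegrable_iff_integrableOn_Ioo_of_le zero_le_one] at this
  · have := integral_cpow (a := 0) (b := 1) (r := s - 1) (Or.inl (by simpa))
    rw [intervalIntegral.integral_of_le zero_le_one, integral_Ioc_eq_integral_Ioo] at this
    rw [this]
    simp [hne]

/-- Both claims come from differentiating the Mellin transform `1/s` of the indicator function of
`(0, 1)`. -/
lemma integral_cpow_sub_one_mul_log_unit {s : ℂ} (hs : 0 < s.re) :
    IntegrableOn (fun u : ℝ => (u : ℂ) ^ (s - 1) * (Real.log u : ℂ)) (Ioo 0 1) ∧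
      ∫ u in Ioo (0 : ℝ) 1, (u : ℂ) ^ (s - 1) * (Real.log u : ℂ) = -1 / s ^ 2 := by
  have hne : s ≠ 0 := fun h => by simp [h] at hs
  set f : ℝ → ℂ := indicator (Ioo 0 1) fun _ => 1 with hf
  have hloc : LocallyIntegrableOn f (Ioi 0) := by
    refine IntegrableOn.locallyIntegrableOn ?_
    refine Integrable.integrableOn ?_
    exact (integrable_indicator_iff measurableSet_Ioo).2 (integrableOn_const (by simp))
  have htop : f =O[atTop] fun x : ℝ => x ^ (-(s.re + 1)) := by
    refine (Asymptotics.isBigO_zero _ _).congr' ?_ EventuallyEq.rfl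
    filter_upwards [eventually_gt_atTop 1] with x hx
    rw [hf, indicator_of_notMem (by simp [hx.le])]
  have hbot : f =O[𝓝[>] 0] fun x : ℝ => x ^ (-(0 : ℝ)) := by
    simp only [neg_zero, Real.rpow_zero]
    refine Asymptotics.IsBigO.of_bound 1 (Eventually.of_forall fun x => ?_)
    rw [hf, norm_one, mul_one]
    exact (norm_indicator_le_norm_self _ _).trans (by simp)
  have h := mellin_hasDerivAt_of_isBigO_rpow hloc htop (lt_add_one s.re) hbot hs
  have hm : ∀ w : ℂ, 0 < w.re → mellin f w = 1 / w := by
    intro w hw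
    rw [← (integral_cpow_sub_one_unit hw).2, mellin, ← integral_indicator measurableSet_Ioo,
      ← integral_indicator measurableSet_Ioi]
    congr 1
    funext t
    by_cases ht : t ∈ Ioo (0 : ℝ) 1
    · simp [hf, ht, ht.1, indicator]
    · simp [hf, ht, indicator]
  have hl : (fun t : ℝ => indicator (Ioi 0) (fun t : ℝ => (t : ℂ) ^ (s - 1) • (Real.log t • f t)) t)
      = indicator (Ioo 0 1) (fun u : ℝ => (u : ℂ) ^ (s - 1) * (Real.log u : ℂ)) := by
    funext t
    by_cases ht : t ∈ Ioo (0 : ℝ) 1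
    · simp [hf, ht, ht.1, indicator]
    · simp [hf, ht, indicator]
  constructor
  · have := h.1
    rw [MellinConvergent, ← integrable_indicator_iff measurableSet_Ioi] at this
    rw [← integrable_indicator_iff measurableSet_Ioo, ← hl]
    exact this
  · have h2 : HasDerivAt (mellin f) (-1 / s ^ 2) s := by
      have h3 : HasDerivAt (fun w : ℂ => 1 / w) (-1 / s ^ 2) s := by
        simpa [one_div, neg_div] using hasDerivAt_inv hne
      refine h3.congr_of_eventuallyEq ?_
      filter_upwards [(isOpen_lt continuous_const Complex.continuous_re).mem_nhds hs] with w hw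
      exact hm w hw
    rw [← h.2.unique h2, mellin, ← integral_indicator measurableSet_Ioo, ← hl,
      ← integral_indicator measurableSet_Ioi]

lemma summable_logTanCoeff_div {σ : ℝ} (hσ : σ < 1) :
    Summable fun k : ℕ => logTanCoeff k / (2 * k + 3 - σ) := by
  have h := ((summable_nat_add_iff 1).2 (Real.summable_one_div_nat_pow.2 one_lt_two)).mul_left
    (realZetaEven 0)
  refine Summable.of_nonneg_of_le (fun k => ?_) (fun k => ?_) h
  · exact div_nonneg (logTanCoeff_pos k).le (by linarith [(k.cast_nonneg : (0 : ℝ) ≤ k)])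
  · have h0 := realZetaEven_pos 0
    have hk : (0 : ℝ) ≤ k := k.cast_nonneg
    calc _ ≤ realZetaEven 0 / (k + 1) / (k + 1) := by
          gcongr
          · exact logTanCoeff_le k
          · linarith
      _ = _ := by push_cast; field_simp

/-- The Mellin-type integral of `log tan (π u / 2)` against `u ^ (-z)`. -/
lemma integral_cpow_neg_mul_logTanUnit {z : ℂ} (hz : z.re < 1) :
    ∫ u in Ioo (0 : ℝ) 1, (u : ℂ) ^ (-z) * (logTanUnit u : ℂ) =
      -(1 / (1 - z) ^ 2) + (Real.log (π / 2) : ℂ) / (1 - z) + ∑' k : ℕ, contTerm z (k + 1) := by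
  have hs : 0 < (1 - z).re := by simpa using hz
  have hP := integral_cpow_sub_one_unit hs
  have hL := integral_cpow_sub_one_mul_log_unit hs
  rw [show (1 - z - 1 : ℂ) = -z by ring] at hP hL
  have hk (k : ℕ) : 0 < ((2 * k + 3 - z : ℂ)).re := by
    have : (0 : ℝ) ≤ k := k.cast_nonneg
    simp; linarith
  have hT (k : ℕ) := integral_cpow_sub_one_unit (hk k)
  have hpow (k : ℕ) : ∀ u ∈ Ioo (0 : ℝ) 1, (logTanCoeff k : ℂ) * (u : ℂ) ^ (2 * k + 3 - z - 1 : ℂ) =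
      (u : ℂ) ^ (-z) * ((logTanCoeff k * u ^ (2 * (k + 1)) : ℝ) : ℂ) := by
    intro u hu
    have hu0 : (u : ℂ) ≠ 0 := by exact_mod_cast hu.1.ne'
    rw [show (2 * k + 3 - z - 1 : ℂ) = -z + ((2 * (k + 1) : ℕ) : ℂ) by push_cast; ring,
      Complex.cpow_add _ _ hu0, Complex.cpow_natCast]
    push_cast
    ring
  have hsum := hasSum_integral_of_summable_integral_norm
    -- The `L¹` norms are exactly `logTanCoeff k / (2k + 3 - Re z)`, which is `O(k^{-2})`.
    (fun k => (hT k).1.const_mul (logTanCoeff k : ℂ)) (by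
      refine (summable_logTanCoeff_div hz).congr fun k => ?_
      have e : ∀ u ∈ Ioo (0 : ℝ) 1, ‖(logTanCoeff k : ℂ) * (u : ℂ) ^ (2 * k + 3 - z - 1 : ℂ)‖ =
          logTanCoeff k * u ^ ((2 * k + 3 - z.re) - 1) := by
        intro u hu
        rw [norm_mul, Complex.norm_of_nonneg (logTanCoeff_pos k).le,
          Complex.norm_cpow_eq_rpow_re_of_pos hu.1]
        simp
      have hk' : (0 : ℝ) ≤ k := k.cast_nonneg
      rw [setIntegral_congr_fun measurableSet_Ioo e, integral_const_mul,
        ← integral_Ioc_eq_integral_Ioo, ← intervalIntegral.integral_of_le zero_le_one,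
        integral_rpow (Or.inl (by linarith)), sub_add_cancel, Real.one_rpow,
        Real.zero_rpow (by linarith), sub_zero, mul_one_div])
  have hval : ∀ u ∈ Ioo (0 : ℝ) 1, ∑' k : ℕ, (logTanCoeff k : ℂ) * (u : ℂ) ^ (2 * k + 3 - z - 1 : ℂ)
      = (u : ℂ) ^ (-z) * (logTanUnit u : ℂ) - ((u : ℂ) ^ (-z) * (Real.log u : ℂ) +
        (Real.log (π / 2) : ℂ) * (u : ℂ) ^ (-z)) := by
    intro u hu
    have := (Complex.hasSum_ofReal.2 (hasSum_logTanUnit hu)).mul_left ((u : ℂ) ^ (-z))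
    simp only [hpow _ u hu]
    rw [this.tsum_eq]
    push_cast
    ring
  rw [setIntegral_congr_fun measurableSet_Ioo hval] at hsum
  have hlogc : IntegrableOn (fun u : ℝ => (Real.log (π / 2) : ℂ) * (u : ℂ) ^ (-z)) (Ioo 0 1) :=
    Integrable.const_mul hP.1 _
  rw [integral_sub (integrableOn_cpow_neg_mul_logTanUnit hz) (by exact Integrable.add hL.1 hlogc),
    integral_add hL.1 hlogc, integral_const_mul, hP.2, hL.2] at hsum
  have hc := hsum.tsum_eq
  simp only [integral_const_mul, (hT _).2, mul_one_div] at hc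
  simp only [contTerm_succ, hc]
  ring

/-! ### The explicit formula: analyticity and poles. -/

/-- The explicit formula holds in the strip `0 < Re z < 1`. -/
lemma contFormula_eq_logTanMellin {z : ℂ} (hz : 0 < z.re) (hz1 : z.re < 1) :
    contFormula z = π / 2 * logTanMellin z := by
  have h1 := integral_cpow_neg_mul_logTanUnit hz1
  have h2 := integral_hurwitzZeta_sub_cpow_mul_logTanUnit hz hz1
  have h3 : logTanMellin z = (∫ u in Ioo (0 : ℝ) 1, (HurwitzZeta.hurwitzZeta (u : UnitAddCircle) z -
      (u : ℂ) ^ (-z)) * (logTanUnit u : ℂ)) +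
      ∫ u in Ioo (0 : ℝ) 1, (u : ℂ) ^ (-z) * (logTanUnit u : ℂ) := by
    rw [← integral_add _ (integrableOn_cpow_neg_mul_logTanUnit hz1), logTanMellin]
    · refine setIntegral_congr_fun measurableSet_Ioo fun u _ => ?_
      ring
    · refine ((integrableOn_hurwitzZeta_mul_logTanUnit hz1).sub
        (integrableOn_cpow_neg_mul_logTanUnit hz1)).congr (Eventually.of_forall fun u => ?_)
      simp only [Pi.sub_apply]
      ring
  have hp : (π : ℂ) ≠ 0 := by exact_mod_cast Real.pi_ne_zero
  rw [h3, h1, h2, contFormula]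
  field_simp
  ring

/-- Discarding the first `K > ‖z‖` terms keeps every remaining denominator at least `k + 1` in size,
so the tail has no poles in the ball of radius `K` and a majorant uniform there. -/
lemma norm_contTerm_le {K : ℕ} {z : ℂ} (hz : ‖z‖ < K) (k : ℕ) :
    ‖contTerm z (k + K + 1)‖ ≤ realZetaEven 0 * (1 / ((k + 1 : ℕ) : ℝ) ^ 2) := by
  have hk : (0 : ℝ) ≤ k := k.cast_nonneg
  have hK : (0 : ℝ) ≤ K := K.cast_nonneg
  have h0 := realZetaEven_pos 0
  have h1 : (k : ℝ) + 1 ≤ ‖(2 * ((k + K : ℕ) : ℂ) + 3 - z)‖ := by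
    have h2 := norm_sub_norm_le (2 * ((k + K : ℕ) : ℂ) + 3) z
    have h3 : ‖(2 * ((k + K : ℕ) : ℂ) + 3)‖ = 2 * (k + K) + 3 := by
      rw [show (2 * ((k + K : ℕ) : ℂ) + 3) = ((2 * (k + K) + 3 : ℝ) : ℂ) by push_cast; rfl,
        Complex.norm_of_nonneg (by positivity)]
    linarith
  rw [contTerm_succ, norm_div, Complex.norm_of_nonneg (logTanCoeff_pos _).le]
  calc _ ≤ realZetaEven 0 / ((k : ℝ) + 1) / ((k : ℝ) + 1) := by
        gcongr
        refine (logTanCoeff_le _).trans ?_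
        push_cast
        gcongr
        linarith
    _ = _ := by push_cast; field_simp

lemma summable_realZetaEven_zero_mul :
    Summable fun k : ℕ => realZetaEven 0 * (1 / ((k + 1 : ℕ) : ℝ) ^ 2) :=
  ((summable_nat_add_iff 1).2 (Real.summable_one_div_nat_pow.2 one_lt_two)).mul_left _

lemma summable_contTerm_succ (z : ℂ) : Summable fun k : ℕ => contTerm z (k + 1) := by
  obtain ⟨K, hK⟩ := exists_nat_gt ‖z‖
  exact (summable_nat_add_iff K).1
    (Summable.of_norm_bounded summable_realZetaEven_zero_mul (norm_contTerm_le hK))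

lemma analyticAt_contTerm_succ {z₀ : ℂ} {k : ℕ} (h : z₀ ≠ 2 * k + 3) :
    AnalyticAt ℂ (fun z => contTerm z (k + 1)) z₀ := by
  simp only [contTerm_succ]
  exact analyticAt_const.div (by fun_prop) (sub_ne_zero.2 h.symm)

lemma analyticAt_tsum_contTerm {K : ℕ} {z₀ : ℂ} (hz₀ : ‖z₀‖ < K) :
    AnalyticAt ℂ (fun z => ∑' k : ℕ, contTerm z (k + K + 1)) z₀ := by
  have h : DifferentiableOn ℂ (fun z => ∑' k : ℕ, contTerm z (k + K + 1)) (Metric.ball 0 K) := by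
    refine Complex.differentiableOn_tsum_of_summable_norm summable_realZetaEven_zero_mul
      (fun k z hz => ?_) Metric.isOpen_ball fun k z hz => norm_contTerm_le (by simpa using hz) k
    refine (analyticAt_contTerm_succ fun h => ?_).differentiableAt.differentiableWithinAt
    have h1 : ‖z‖ < K := by simpa using hz
    have h2 := (Complex.re_le_norm z).trans_lt h1
    rw [h] at h2
    simp at h2
    linarith [(k.cast_nonneg : (0 : ℝ) ≤ k), (K.cast_nonneg : (0 : ℝ) ≤ K)]
  exact h.analyticAt (Metric.isOpen_ball.mem_nhds (by simpa using hz₀))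

lemma isOpen_re_pos : IsOpen {z : ℂ | 0 < z.re} :=
  isOpen_lt continuous_const Complex.continuous_re

/-- This is the Mellin transform of `w(y) e^{-y}`, which is bounded near `0` and decays
exponentially. -/
lemma analyticAt_integral_weightIntegrand {z₀ : ℂ} (hz₀ : 0 < z₀.re) :
    AnalyticAt ℂ (fun z => ∫ y in Ioi (0 : ℝ), weightIntegrand z y) z₀ := by
  refine DifferentiableOn.analyticAt (s := {z : ℂ | 0 < z.re}) (fun z hz => ?_)
    (isOpen_re_pos.mem_nhds hz₀)
  set f : ℝ → ℂ := fun y => (weightW y : ℂ) * (Real.exp (-y) : ℂ) with hf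
  set W := ∑' n : ℕ, oddHarmonic n / (n : ℝ) ^ 2 with hW
  have hcont : Continuous f := by
    have := Complex.continuous_ofReal.comp continuous_weightW
    simp only [Function.comp_def] at this
    fun_prop
  have hnorm (y : ℝ) : ‖f y‖ ≤ W * ‖Real.exp (-1 * y)‖ := by
    rw [hf]
    simp only [norm_mul, neg_one_mul, Complex.norm_real]
    gcongr
    rw [Real.norm_of_nonneg (weightW_nonneg y)]
    exact weightW_le y
  have h : DifferentiableAt ℂ (mellin f) z := by
    refine mellin_differentiableAt_of_isBigO_rpow_exp (a := 1) (b := 0) one_pos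
      (hcont.continuousOn.locallyIntegrableOn measurableSet_Ioi)
      (Asymptotics.IsBigO.of_bound W (Eventually.of_forall hnorm)) ?_ hz
    simp only [neg_zero, Real.rpow_zero]
    exact (hcont.tendsto 0).isBigO_one ℝ |>.mono nhdsWithin_le_nhds
  refine DifferentiableAt.differentiableWithinAt ?_
  refine h.congr_of_eventuallyEq (Eventually.of_forall fun w => ?_)
  rw [mellin]
  refine setIntegral_congr_fun measurableSet_Ioi fun y _ => ?_
  simp only [weightIntegrand, hf, smul_eq_mul]
  ring

/-- Near a point of `Re z > 0` the explicit formula is its first polar terms plus an analytic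
function. -/
lemma exists_contFormula_eventuallyEq {z₀ : ℂ} (hz₀ : 0 < z₀.re) (N : ℕ) :
    ∃ K ≥ N, ∃ R : ℂ → ℂ, AnalyticAt ℂ R z₀ ∧ contFormula =ᶠ[𝓝 z₀] fun z =>
      -(π / 2) * (1 / (1 - z) ^ 2) + (π / 2) * ((Real.log (π / 2) : ℂ) / (1 - z)) +
        (π / 2) * ∑ k ∈ Finset.range K, contTerm z (k + 1) + R z := by
  -- Exceeding `‖z₀‖` makes the tail analytic at `z₀`; exceeding `N` lets a prescribed polar term be
  -- placed in the finite sum.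
  obtain ⟨K₀, hK₀⟩ := exists_nat_gt ‖z₀‖
  have hK : ‖z₀‖ < (max K₀ N : ℕ) := hK₀.trans_le (by exact_mod_cast le_max_left _ _)
  refine ⟨max K₀ N, le_max_right _ _, fun z => (π / 2) * ∑' k : ℕ, contTerm z (k + max K₀ N + 1) -
    1 / π * (1 / Complex.Gamma z) * ∫ y in Ioi (0 : ℝ), weightIntegrand z y, ?_, ?_⟩
  · have hΓ : AnalyticAt ℂ (fun z => 1 / Complex.Gamma z) z₀ := by
      simp only [one_div]
      exact Complex.differentiable_one_div_Gamma.analyticAt z₀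
    exact (analyticAt_const.mul (analyticAt_tsum_contTerm hK)).sub
      ((analyticAt_const.mul hΓ).mul (analyticAt_integral_weightIntegrand hz₀))
  · refine Eventually.of_forall fun z => ?_
    rw [contFormula, ← (summable_contTerm_succ z).sum_add_tsum_nat_add (max K₀ N)]
    ring

lemma analyticAt_contFormula {z₀ : ℂ} (hz₀ : 0 < z₀.re) (hodd : ∀ n : ℕ, z₀ ≠ 2 * n + 1) :
    AnalyticAt ℂ contFormula z₀ := by
  obtain ⟨K, -, R, hR, hE⟩ := exists_contFormula_eventuallyEq hz₀ 0
  refine AnalyticAt.congr ?_ hE.symm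
  have h1 : (1 - z₀) ≠ 0 := fun h => hodd 0 (by simpa using (sub_eq_zero.1 h).symm)
  refine ((AnalyticAt.add ?_ ?_).add ?_).add hR
  · exact analyticAt_const.mul (analyticAt_const.div (by fun_prop) (pow_ne_zero 2 h1))
  · exact analyticAt_const.mul (analyticAt_const.div (by fun_prop) h1)
  · refine analyticAt_const.mul (Finset.analyticAt_fun_sum _ fun k _ => ?_)
    exact analyticAt_contTerm_succ fun h => hodd (k + 1) (by rw [h]; push_cast; ring)

lemma meromorphicOrderAt_neg_of_eventuallyEq {f g : ℂ → ℂ} {z₀ : ℂ} {p : ℕ} (hp : p ≠ 0)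
    (hg : AnalyticAt ℂ g z₀) (hg0 : g z₀ ≠ 0)
    (h : ∀ᶠ z in 𝓝[≠] z₀, f z = (z - z₀) ^ (-(p : ℤ)) • g z) :
    MeromorphicAt f z₀ ∧ meromorphicOrderAt f z₀ < 0 := by
  have hm : MeromorphicAt (fun z => (z - z₀) ^ (-(p : ℤ)) • g z) z₀ := by fun_prop
  have hf : MeromorphicAt f z₀ := hm.congr (by filter_upwards [h] with z hz using hz.symm)
  refine ⟨hf, ?_⟩
  rw [(meromorphicOrderAt_eq_int_iff hf).2 ⟨g, hg, hg0, h⟩]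
  exact_mod_cast (by omega : -(p : ℤ) < 0)

/-- At `1` there is a double pole with leading coefficient `-π/2`. At `2k + 3` only one term of the
series is singular, and its residue `-(π/2) logTanCoeff k` is nonzero. -/
lemma meromorphicAt_contFormula_odd (n : ℕ) :
    MeromorphicAt contFormula (2 * n + 1) ∧ meromorphicOrderAt contFormula (2 * n + 1) < 0 := by
  have hre : 0 < (2 * n + 1 : ℂ).re := by
    have : (0 : ℝ) ≤ n := n.cast_nonneg
    simp; linarith
  obtain ⟨K, hK, R, hR, hE⟩ := exists_contFormula_eventuallyEq hre (n + 1)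
  have hp : (π : ℂ) ≠ 0 := by exact_mod_cast Real.pi_ne_zero
  have hne : ∀ᶠ z : ℂ in 𝓝[≠] (2 * (n : ℂ) + 1), z ≠ 2 * n + 1 := self_mem_nhdsWithin
  rcases n with _ | n
  · simp only [Nat.cast_zero, mul_zero, zero_add] at *
    refine meromorphicOrderAt_neg_of_eventuallyEq (p := 2) two_ne_zero
      (g := fun z => -(π / 2 : ℂ) - (π / 2) * (Real.log (π / 2) : ℂ) * (z - 1) + (z - 1) ^ 2 *
        ((π / 2) * ∑ k ∈ Finset.range K, contTerm z (k + 1) + R z)) ?_ (by simp) ?_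
    · refine AnalyticAt.add (by fun_prop) (AnalyticAt.mul (by fun_prop) (AnalyticAt.add ?_ hR))
      refine analyticAt_const.mul (Finset.analyticAt_fun_sum _ fun k _ => ?_)
      refine analyticAt_contTerm_succ fun h => ?_
      have := congrArg Complex.re h
      simp at this
      linarith [(k.cast_nonneg : (0 : ℝ) ≤ k)]
    · filter_upwards [hne, hE.filter_mono nhdsWithin_le_nhds] with z hz hEz
      have h1 : z - 1 ≠ 0 := sub_ne_zero.2 hz
      have h2 : 1 - z ≠ 0 := sub_ne_zero.2 hz.symm
      rw [hEz, smul_eq_mul, zpow_neg, show (1 - z) = -(z - 1) by ring]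
      rw [show ((2 : ℕ) : ℤ) = 2 by rfl, zpow_ofNat]
      field_simp
      ring
  -- After the case split the index has dropped by one: the pole is at `2n + 3` and comes from the
  -- term with index `n`.
  · set z₀ : ℂ := 2 * ((n + 1 : ℕ) : ℂ) + 1 with hz₀
    have hz₀' : z₀ = 2 * n + 3 := by rw [hz₀]; push_cast; ring
    have h10 : 1 - z₀ ≠ 0 := by
      intro h
      have := congrArg Complex.re h
      simp [hz₀'] at this
      linarith [(n.cast_nonneg : (0 : ℝ) ≤ n)]
    have hmem : n ∈ Finset.range K := Finset.mem_range.2 (by omega)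
    refine meromorphicOrderAt_neg_of_eventuallyEq (p := 1) one_ne_zero
      (g := fun z => -(π / 2 : ℂ) * logTanCoeff n + (z - z₀) *
        (-(π / 2) * (1 / (1 - z) ^ 2) + (π / 2) * ((Real.log (π / 2) : ℂ) / (1 - z)) +
        (π / 2) * ∑ k ∈ (Finset.range K).erase n, contTerm z (k + 1) + R z)) ?_ ?_ ?_
    · refine AnalyticAt.add (by fun_prop) (AnalyticAt.mul (by fun_prop)
        (((AnalyticAt.add ?_ ?_).add ?_).add hR))
      · exact analyticAt_const.mul (analyticAt_const.div (by fun_prop) (pow_ne_zero 2 h10))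
      · exact analyticAt_const.mul (analyticAt_const.div (by fun_prop) h10)
      · refine analyticAt_const.mul (Finset.analyticAt_fun_sum _ fun k hk => ?_)
        refine analyticAt_contTerm_succ fun h => Finset.ne_of_mem_erase hk ?_
        rw [hz₀'] at h
        have h4 : (k : ℂ) = n := by linear_combination -h / 2
        exact_mod_cast h4
    · have := (logTanCoeff_pos n).ne'
      simp [hp, this]
    · filter_upwards [hne, hE.filter_mono nhdsWithin_le_nhds] with z hz hEz
      have h1 : z - z₀ ≠ 0 := sub_ne_zero.2 hz
      have h2 : (2 * n + 3 - z : ℂ) = -(z - z₀) := by rw [hz₀']; ring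
      rw [hEz, ← Finset.add_sum_erase _ _ hmem, contTerm_succ, h2, smul_eq_mul, zpow_neg,
        show ((1 : ℕ) : ℤ) = 1 by rfl, zpow_one, mul_add (z - z₀)⁻¹, inv_mul_cancel_left₀ h1]
      field_simp
      ring

/-! ### The global continuations of the integral and of `ζ_h`. -/

lemma intervalIntegrable_logTanHurwitz {z : ℂ} (hz : z.re < 1) :
    IntervalIntegrable (logTanHurwitz z) volume 0 (π / 2) :=
  (intervalIntegrable_comp_two_mul_div_pi_iff
    fun u => HurwitzZeta.hurwitzZeta (u : UnitAddCircle) z).2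
    (integrableOn_hurwitzZeta_mul_logTanUnit hz)

lemma integral_logTanHurwitz (z : ℂ) :
    ∫ x in (0 : ℝ)..(π / 2), logTanHurwitz z x = π / 2 * logTanMellin z :=
  integral_comp_two_mul_div_pi fun u => HurwitzZeta.hurwitzZeta (u : UnitAddCircle) z

/-- The meromorphic continuation of the log-tangent integral of the Hurwitz zeta function. -/
noncomputable def logTanCont (z : ℂ) : ℂ :=
  if z.re < 1 then ∫ x in (0 : ℝ)..(π / 2), logTanHurwitz z x else contFormula z

lemma logTanCont_of_re_lt_one {z : ℂ} (hz : z.re < 1) :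
    logTanCont z = π / 2 * logTanMellin z := by
  rw [logTanCont, if_pos hz, integral_logTanHurwitz]

/-- Agreement in the strip `0 < Re z < 1` extends the formula to an open half-plane containing the
line `Re z = 1`, where the definition switches branches. -/
lemma logTanCont_eq_contFormula {z : ℂ} (hz : 0 < z.re) : logTanCont z = contFormula z := by
  by_cases h : z.re < 1
  · rw [logTanCont_of_re_lt_one h, contFormula_eq_logTanMellin hz h]
  · rw [logTanCont, if_neg h]

lemma logTanCont_eventuallyEq {z₀ : ℂ} (hz₀ : 0 < z₀.re) : logTanCont =ᶠ[𝓝 z₀] contFormula := by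
  filter_upwards [isOpen_re_pos.mem_nhds hz₀] with z hz using logTanCont_eq_contFormula hz

lemma analyticAt_logTanCont {z₀ : ℂ} (hodd : ∀ n : ℕ, z₀ ≠ 2 * n + 1) :
    AnalyticAt ℂ logTanCont z₀ := by
  by_cases h : 0 < z₀.re
  · exact (analyticAt_contFormula h hodd).congr (logTanCont_eventuallyEq h).symm
  · have h1 : z₀.re < 1 := by linarith
    refine (analyticAt_const.mul (analyticOnNhd_logTanMellin z₀ h1)).congr
      (f := fun z => (π / 2 : ℂ) * logTanMellin z) ?_
    filter_upwards [isOpen_re_lt_one.mem_nhds h1] with z hz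
    exact (logTanCont_of_re_lt_one hz).symm

lemma meromorphicAt_logTanCont_odd (n : ℕ) :
    MeromorphicAt logTanCont (2 * n + 1) ∧ meromorphicOrderAt logTanCont (2 * n + 1) < 0 := by
  have hre : 0 < (2 * n + 1 : ℂ).re := by
    have : (0 : ℝ) ≤ n := n.cast_nonneg
    simp; linarith
  have hE : logTanCont =ᶠ[𝓝[≠] (2 * (n : ℂ) + 1)] contFormula :=
    (logTanCont_eventuallyEq hre).filter_mono nhdsWithin_le_nhds
  have h := meromorphicAt_contFormula_odd n
  exact ⟨h.1.congr hE.symm, by rw [meromorphicOrderAt_congr hE]; exact h.2⟩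

/-- The functional equation relating `ζ_h` and the log-tangent integral. -/
lemma zetaH_eq_logTanCont {s : ℂ} (hs : 1 < s.re) (hs2 : s.re < 2) :
    zetaH s = -(2 : ℂ) ^ (s - 1) * (π : ℂ) ^ (s - 2) * Complex.sin (π * s / 2) *
      Complex.Gamma (2 - s) * logTanCont (2 - s) := by
  have hp : (π : ℂ) ≠ 0 := by exact_mod_cast Real.pi_ne_zero
  have hre : (2 - s).re < 1 := by simp; linarith
  -- No integer lies strictly between `0` and `1`, so the reflection formula at `s - 1` has a
  -- nonzero denominator; it then cancels the cosine and `Γ(s - 1)`.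
  have hsin : Complex.sin (π * (s - 1)) ≠ 0 := by
    intro h
    obtain ⟨k, hk⟩ := Complex.sin_eq_zero_iff.1 h
    have hk2 : s - 1 = k := by
      rw [mul_comm] at hk
      exact mul_right_cancel₀ hp hk
    have h3 := congrArg Complex.re hk2
    simp at h3
    have h4 : (0 : ℝ) < k := by linarith
    have h5 : (k : ℝ) < 1 := by linarith
    have h6 : (0 : ℤ) < k := by exact_mod_cast h4
    have h7 : k < (1 : ℤ) := by exact_mod_cast h5
    omega
  have hΓ := Complex.Gamma_mul_Gamma_one_sub (s - 1)
  rw [show 1 - (s - 1) = 2 - s by ring, eq_div_iff hsin] at hΓ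
  have hsin2 : Complex.sin (π * (s - 1)) = -(2 * Complex.sin (π * s / 2) * Complex.cos (π * s / 2))
      := by
    rw [← Complex.sin_two_mul, show (π * (s - 1) : ℂ) = 2 * (π * s / 2) - π by ring,
      Complex.sin_sub_pi]
  rw [hsin2] at hΓ
  have hpow : (2 : ℂ) ^ (s - 1) * (π : ℂ) ^ (s - 2) * (2 * π : ℂ) ^ (2 - s - 1) = 1 / π := by
    have h1 : (2 * π : ℂ) ^ (2 - s - 1) = (2 : ℂ) ^ (2 - s - 1) * (π : ℂ) ^ (2 - s - 1) := by
      have := Complex.mul_cpow_ofReal_nonneg (zero_le_two (α := ℝ)) Real.pi_pos.le (2 - s - 1)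
      simpa using this
    rw [h1, mul_mul_mul_comm, ← Complex.cpow_add _ _ two_ne_zero, ← Complex.cpow_add _ _ hp]
    rw [show s - 1 + (2 - s - 1) = 0 by ring, show s - 2 + (2 - s - 1) = -1 by ring]
    simp [Complex.cpow_neg_one]
  rw [logTanCont_of_re_lt_one hre, logTanMellin_eq hre, show (1 - (2 - s)) = s - 1 by ring,
    sub_sub_cancel, show (π * (2 - s) / 2 : ℂ) = π - π * s / 2 by ring, Complex.cos_pi_sub]
  calc zetaH s = (1 / π) * (π * zetaH s) := by field_simp
    _ = ((2 : ℂ) ^ (s - 1) * (π : ℂ) ^ (s - 2) * (2 * π : ℂ) ^ (2 - s - 1)) *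
        ((Complex.Gamma (s - 1) * Complex.Gamma (2 - s) *
          -(2 * Complex.sin (π * s / 2) * Complex.cos (π * s / 2))) * zetaH s) := by
        rw [hpow, hΓ]
    _ = _ := by field_simp; ring

/-- The second branch is analytic for `Re s < 2` except where `2 - s` is an odd positive integer,
and it equals `ζ_h` for `1 < Re s < 2`, so the two branches glue across `Re s = 1`. -/
lemma analyticAt_zetaH_continuation {s₀ : ℂ} (hs₀ : ∀ n : ℕ, s₀ ≠ 1 - 2 * n) :
    AnalyticAt ℂ (fun s : ℂ => if 1 < s.re then zetaH s else
      -(2 : ℂ) ^ (s - 1) * (π : ℂ) ^ (s - 2) * Complex.sin (π * s / 2) *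
        Complex.Gamma (2 - s) * logTanCont (2 - s)) s₀ := by
  have hp : (π : ℂ) ≠ 0 := by exact_mod_cast Real.pi_ne_zero
  by_cases h : 1 < s₀.re
  · refine (analyticOnNhd_zetaH s₀ h).congr ?_
    filter_upwards [(isOpen_lt continuous_const Complex.continuous_re).mem_nhds h] with s hs
    exact (if_pos hs).symm
  · have h2 : s₀.re < 2 := by linarith
    have hopen : {s : ℂ | s.re < 2} ∈ 𝓝 s₀ :=
      (isOpen_lt Complex.continuous_re continuous_const).mem_nhds h2
    have hG : AnalyticAt ℂ logTanCont (2 - s₀) := analyticAt_logTanCont fun n hn =>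
      hs₀ n (by linear_combination -hn)
    have hΓ : AnalyticAt ℂ (fun s : ℂ => Complex.Gamma (2 - s)) s₀ := by
      refine DifferentiableOn.analyticAt (s := {s : ℂ | s.re < 2}) (fun s hs => ?_) hopen
      refine (DifferentiableAt.comp (f := fun s : ℂ => 2 - s) (g := Complex.Gamma) _
        (Complex.differentiableAt_Gamma _ fun n h => ?_) (by fun_prop)).differentiableWithinAt
      have h3 := congrArg Complex.re h
      have hs : s.re < 2 := hs
      simp at h3
      linarith [(n.cast_nonneg : (0 : ℝ) ≤ n)]
    have hE : AnalyticAt ℂ (fun s : ℂ => -(2 : ℂ) ^ (s - 1) * (π : ℂ) ^ (s - 2) *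
        Complex.sin (π * s / 2) * Complex.Gamma (2 - s) * logTanCont (2 - s)) s₀ := by
      have he : AnalyticAt ℂ (fun s : ℂ => -(2 : ℂ) ^ (s - 1) * (π : ℂ) ^ (s - 2) *
          Complex.sin (π * s / 2)) s₀ := by
        refine Differentiable.analyticAt ?_ s₀
        refine Differentiable.mul (Differentiable.mul (Differentiable.neg ?_) ?_) (by fun_prop)
        · exact fun s => DifferentiableAt.const_cpow (by fun_prop) (Or.inl two_ne_zero)
        · exact fun s => DifferentiableAt.const_cpow (by fun_prop) (Or.inl hp)
      exact (he.mul hΓ).mul (AnalyticAt.comp (f := fun s : ℂ => 2 - s) hG (by fun_prop))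
    refine hE.congr ?_
    filter_upwards [hopen] with s hs
    by_cases h1 : 1 < s.re
    · rw [if_pos h1, zetaH_eq_logTanCont h1 hs]
    · rw [if_neg h1]

end

theorem mainTheorem7 :
    -- convergence, and the integral representation for `Re s > 1`, `s` not an odd integer
    (∀ s : ℂ, 1 < s.re →
      LSeriesSummable (fun n => (oddHarmonic n : ℂ)) s ∧
      IntervalIntegrable (logTanHurwitz (2 - s)) MeasureTheory.volume 0 (Real.pi / 2) ∧
      ((∀ n : ℕ, s ≠ 2 * n + 1) →
        zetaH s =
          (2 * Real.pi : ℂ) ^ (s - 1)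
              / (2 * Complex.Gamma (s - 1) * Complex.cos (Real.pi * s / 2))
            * ∫ x in (0 : ℝ)..(Real.pi / 2), logTanHurwitz (2 - s) x)) ∧
    -- the analogue at the odd integers `s = 2n + 1`, `n ≥ 1`
    (∀ n : ℕ, 1 ≤ n →
      IntervalIntegrable (logTanHurwitzDeriv (1 - 2 * n)) MeasureTheory.volume
        0 (Real.pi / 2) ∧
      zetaH (2 * n + 1) =
        (-1) ^ n * 2 ^ (2 * n) * (Real.pi : ℂ) ^ (2 * n - 1) / ((2 * n - 1).factorial : ℂ)
          * ∫ x in (0 : ℝ)..(Real.pi / 2), logTanHurwitzDeriv (1 - 2 * n) x) ∧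
    -- the continuation `G` of the log-tangent integral, and of `ζ_h` through it
    ∃ G : ℂ → ℂ,
      (∀ z : ℂ, z.re < 1 →
        IntervalIntegrable (logTanHurwitz z) MeasureTheory.volume 0 (Real.pi / 2) ∧
        G z = ∫ x in (0 : ℝ)..(Real.pi / 2), logTanHurwitz z x) ∧
      (∀ y : ℝ, 0 < y → Summable (fun n : ℕ => weightTerm y (n + 1))) ∧
      (∀ z : ℂ, 1 ≤ z.re →
        MeasureTheory.IntegrableOn (weightIntegrand z) (Set.Ioi (0 : ℝ))) ∧
      (∀ z : ℂ, 1 ≤ z.re → (∀ n : ℕ, z ≠ 2 * n + 1) →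
        Summable (fun k : ℕ => contTerm z (k + 1)) ∧
        G z = contFormula z) ∧
      AnalyticOnNhd ℂ G {z : ℂ | ∀ n : ℕ, z ≠ 2 * n + 1} ∧
      (∀ n : ℕ, MeromorphicAt G (2 * n + 1) ∧ meromorphicOrderAt G (2 * n + 1) < 0) ∧
      AnalyticOnNhd ℂ
        (fun s : ℂ =>
          if 1 < s.re then zetaH s
          else -(2 : ℂ) ^ (s - 1) * (Real.pi : ℂ) ^ (s - 2) * Complex.sin (Real.pi * s / 2)
            * Complex.Gamma (2 - s) * G (2 - s))
        {s : ℂ | ∀ n : ℕ, s ≠ 1 - 2 * n} := by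
  refine ⟨fun s hs => ⟨lseriesSummable_oddHarmonic hs,
    intervalIntegrable_logTanHurwitz (by simp; linarith), fun hodd => ?_⟩, fun n hn => ⟨?_, ?_⟩,
    logTanCont, fun z hz => ⟨intervalIntegrable_logTanHurwitz hz, if_pos hz⟩,
    fun y _ => (summable_nat_add_iff 1).2 (summable_weightTerm y),
    fun z hz => integrableOn_weightIntegrand (by linarith),
    fun z hz _ => ⟨summable_contTerm_succ z, logTanCont_eq_contFormula (by linarith)⟩,
    fun z hz => analyticAt_logTanCont hz, meromorphicAt_logTanCont_odd,
    fun s hs => analyticAt_zetaH_continuation hs⟩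
  · rw [integral_logTanHurwitz]
    exact zetaH_eq_logTanMellin hs hodd
  · have hre : (1 - 2 * n : ℂ).re < 1 := by simp; omega
    exact (intervalIntegrable_comp_two_mul_div_pi_iff
      fun u => deriv (HurwitzZeta.hurwitzZeta (u : UnitAddCircle)) (1 - 2 * n)).2
      (hasDerivAt_logTanMellin hre).1
  · rw [zetaH_two_mul_add_one hn, ← integral_comp_two_mul_div_pi
      fun u => deriv (HurwitzZeta.hurwitzZeta (u : UnitAddCircle)) (1 - 2 * n)]
    rfl
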